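/- Let $n\ge 1$ and let $k$ be an integer with $0\le k\le\frac{n-1}{2}$. Let $(N^{n-1},g_N)$ be a connected smooth Riemannian manifold, $0<\bar r\le\infty$, and $\lambda:[0,\bar r)\to(0,\infty)$ smooth (no log-convexity is assumed). Let $M^n=[0,\bar r)\times_\lambda N$ be the warped product with metric $\bar g=dr^2+\lambda(r)^2g_N$. Let $f:(\Sigma^{n-1},g)\to(M,\bar g)$ be an isometrically immersed smooth hypersurface, where $(\Sigma,g)$ is a connected complete Riemannian manifold, with a smooth unit normal field $\nu$ along $f$, and assume that $\Sigma$ is star-shaped, i.e. $\langle\partial_r,\nu\rangle\ge 0$ (this includes graphs over $N$ with their outer normal). Denote by $r:\Sigma\to[0,\bar r)$ the height function (first component of $f$), and by $h_{ij}=-\langle\bar\nabla_{\partial_i}\partial_j,\nu\rangle$ the second fundamental form with respect to $-\nu$, where $\bar\nabla$ is the Levi-Civita connection of $\bar g$. Let ${R_{ij}}^{kl}$ be the curvature tensor of $g$, with the sign for which ${R_{ij}}^{ij}$ is the scalar curvature, let $\delta^{j_1\cdots j_r}_{i_1\cdots i_r}=\det(\delta^{j_b}_{i_a})$, and set $$E_{(k)}^{ij}=-\frac1{2^{k+1}}\,g^{lj}\,\delta^{i\,i_1\cdots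 i_{2k}}_{l\,j_1\cdots j_{2k}}{R_{i_1i_2}}^{j_1j_2}\cdots{R_{i_{2k-1}i_{2k}}}^{j_{2k-1}j_{2k}},$$ $$\mathcal H_{2k}=\frac1{2^{k}}\,\delta^{i_1\cdots i_{2k}}_{j_1\cdots j_{2k}}{R_{i_1i_2}}^{j_1j_2}\cdots{R_{i_{2k-1}i_{2k}}}^{j_{2k-1}j_{2k}},\qquad \mathcal H_{2k+1}=-2E_{(k)}^{ij}h_{ij}$$ (so $E_{(0)}=-\frac12g$ and $\mathcal H_0=1$). Assume: 1. $\Sigma$ lies in a slab: $r(\Sigma)\subset[r_1,r_2]$ with $r_1,r_2\in[0,\bar r)$; 2. $E_{(k)}$ is semi-definite at every point of $\Sigma$; 3. the Omori–Yau maximum principle holds on $\Sigma$ for $L=\mathrm{tr}(-2E_{(k)}\nabla^2)$, that is $Lu=-2E_{(k)}^{ij}\nabla_i\nabla_ju$: for every $u\in C^2(\Sigma)$ with $\sup_\Sigma u<\infty$ there are points $p_i\in\Sigma$, $i\ge1$, with $u(p_i)>\sup_\Sigma u-\frac1i$, $|\nabla u|(p_i)<\frac1i$ and $Lu(p_i)<\frac1i$;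 4. there are constants $C_1,C_2$ with $0<C_1\le\mathcal H_{2k}\le C_2$ on $\Sigma$; 5. on $\Sigma$, $$\frac{\mathcal H_{2k+1}}{\mathcal H_{2k}}\le(n-1-2k)\frac{\lambda'(r)}{\lambda(r)}\quad\text{and}\quad|\nabla r|\le\inf_\Sigma\left((n-1-2k)\frac{\lambda'(r)}{\lambda(r)}-\frac{\mathcal H_{2k+1}}{\mathcal H_{2k}}\right).$$ Then $\Sigma$ is a slice: there is $r_0\in[0,\bar r)$ with $f(\Sigma)=\{r_0\}\times N$. -/

import Mathlib

open Set Bundle Manifold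
open scoped Manifold ContDiff

namespace WarpedProduct

noncomputable section

/-! ### Metrics and Christoffel symbols in charts -/

/-- The coordinate expression, in the preferred chart `φ` at `p`, of a field `B` of bilinear forms
on the tangent spaces of `M`: at the point `y` of the model space it sends `v`, `w` to
`B ((φ⁻¹)_* v, (φ⁻¹)_* w)`, taken at the point `φ⁻¹ y`. -/
def chartForm {V : Type*} [NormedAddCommGroup V] [NormedSpace ℝ V]
    {H : Type*} [TopologicalSpace H] (I : ModelWithCorners ℝ V H)
    {M : Type*} [TopologicalSpace M] [ChartedSpace H M]
    (B : ∀ q : M, TangentSpace I q → TangentSpace I q → ℝ) (p : M) (y v w : V) : ℝ :=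
  B ((extChartAt I p).symm y)
    (mfderiv 𝓘(ℝ, V) I (extChartAt I p).symm y v)
    (mfderiv 𝓘(ℝ, V) I (extChartAt I p).symm y w)

/-- Christoffel symbols of the first kind at `y` of a metric `G` given on a subset `s` of a vector
space: `½ (∂_u G(v, w) + ∂_v G(u, w) - ∂_w G(u, v)) = G(∇_u v, w)` for constant fields
`u`, `v`, `w`. Derivatives are taken within `s` (one-sided at boundary points of `s`). -/
def christoffelFirst {V : Type*} [NormedAddCommGroup V] [NormedSpace ℝ V]
    (G : V → V → V → ℝ) (s : Set V) (y u v w : V) : ℝ :=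
  (1 / 2) * (fderivWithin ℝ (fun z => G z v w) s y u + fderivWithin ℝ (fun z => G z u w) s y v
    - fderivWithin ℝ (fun z => G z u v) s y w)

/-! ### Intrinsic geometry of an `m`-dimensional Riemannian manifold

Tensors at the point `p` are given by their components with respect to the preferred chart
at `p`. -/

/-- The `i`-th coordinate vector of `ℝ^m`. -/
def stdVec {m : ℕ} (i : Fin m) : EuclideanSpace ℝ (Fin m) := EuclideanSpace.single i 1

section Intrinsic

variable {m : ℕ} {S : Type*} [TopologicalSpace S] [ChartedSpace (EuclideanSpace ℝ (Fin m)) S]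

/-- `∂u / ∂x^i` in the preferred chart at `p`, at the point `p`. -/
def coordDeriv (u : S → ℝ) (p : S) (i : Fin m) : ℝ :=
  fderiv ℝ (u ∘ (extChartAt (𝓡 m) p).symm) (extChartAt (𝓡 m) p p) (stdVec i)

variable [RiemannianBundle (fun x : S => TangentSpace (𝓡 m) x)]

/-- The Riemannian metric of `S` in the preferred chart at `p`. -/
def chartMetric (p : S) : EuclideanSpace ℝ (Fin m) → EuclideanSpace ℝ (Fin m) →
    EuclideanSpace ℝ (Fin m) → ℝ :=
  chartForm (𝓡 m) (fun _ v w => inner ℝ v w) p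

/-- The components `g_{ij}` at the coordinate point `y`. -/
def gram (p : S) (y : EuclideanSpace ℝ (Fin m)) : Matrix (Fin m) (Fin m) ℝ :=
  Matrix.of fun i j => chartMetric p y (stdVec i) (stdVec j)

/-- The components `g^{ij}` of the inverse metric at `p`. -/
def gramInv (p : S) : Matrix (Fin m) (Fin m) ℝ := (gram p (extChartAt (𝓡 m) p p))⁻¹

/-- The Christoffel symbols `Γ^a_{ij}` of the Levi-Civita connection, at the coordinate
point `y`. -/
def christoffel (p : S) (y : EuclideanSpace ℝ (Fin m)) (a i j : Fin m) : ℝ :=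
  ∑ l, (gram p y)⁻¹ a l * christoffelFirst (chartMetric p) univ y (stdVec i) (stdVec j) (stdVec l)

/-- The `a`-th component of `R(∂_i, ∂_j) ∂_l` at `p`, where
`R(X, Y) = ∇_X ∇_Y - ∇_Y ∇_X - ∇_[X, Y]`. -/
def curvature (p : S) (a l i j : Fin m) : ℝ :=
  let y := extChartAt (𝓡 m) p p
  fderiv ℝ (fun z => christoffel p z a j l) y (stdVec i)
    - fderiv ℝ (fun z => christoffel p z a i l) y (stdVec j)
    + ∑ b, (christoffel p y a i b * christoffel p y b j l
        - christoffel p y a j b * christoffel p y b i l)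

/-- The components `R_{ij}^{kl}` at `p`; the sign is such that `∑ R_{ij}^{ij}` is the scalar
curvature (positive on round spheres). -/
def curvatureUp (p : S) (i j k l : Fin m) : ℝ := ∑ c, gramInv p l c * curvature p k c i j

/-- The generalized Kronecker delta `δ^{j_1 … j_r}_{i_1 … i_r} = det (δ^{j_b}_{i_a})`. -/
def genDelta {r : ℕ} (j i : Fin r → Fin m) : ℝ :=
  Matrix.det (Matrix.of fun a b : Fin r => if j b = i a then (1 : ℝ) else 0)

/-- The product `R_{i_1 i_2}^{j_1 j_2} ⋯ R_{i_{2k-1} i_{2k}}^{j_{2k-1} j_{2k}}` at `p`. -/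
def curvatureProd (k : ℕ) (p : S) (i j : Fin (2 * k) → Fin m) : ℝ :=
  ∏ a : Fin k, curvatureUp p
    (i ⟨2 * a.1, by omega⟩) (i ⟨2 * a.1 + 1, by omega⟩)
    (j ⟨2 * a.1, by omega⟩) (j ⟨2 * a.1 + 1, by omega⟩)

variable (m) in
/-- The `k`-th Gauss-Bonnet curvature `L_k`, which is the `2k`-mean curvature `H_{2k}`. -/
def gaussBonnet (k : ℕ) (p : S) : ℝ :=
  1 / 2 ^ k * ∑ i : Fin (2 * k) → Fin m, ∑ j : Fin (2 * k) → Fin m,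
    genDelta i j * curvatureProd k p i j

variable (m) in
/-- The components `E_{(k)}^{ij}` at `p` of the generalized Einstein tensor. -/
def genEinstein (k : ℕ) (p : S) : Matrix (Fin m) (Fin m) ℝ :=
  Matrix.of fun i j => -(1 / 2 ^ (k + 1)) * ∑ l, gramInv p l j *
    ∑ I : Fin (2 * k) → Fin m, ∑ J : Fin (2 * k) → Fin m,
      genDelta (Fin.cons i I : Fin (2 * k + 1) → Fin m) (Fin.cons l J) * curvatureProd k p I J

/-- The components `∇_i ∇_j u` at `p` of the Hessian of `u`. -/
def hessian (u : S → ℝ) (p : S) : Matrix (Fin m) (Fin m) ℝ :=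
  Matrix.of fun i j =>
    fderiv ℝ (fun z => fderiv ℝ (u ∘ (extChartAt (𝓡 m) p).symm) z (stdVec j))
        (extChartAt (𝓡 m) p p) (stdVec i)
      - ∑ a, christoffel p (extChartAt (𝓡 m) p p) a i j * coordDeriv u p a

variable (m) in
/-- `|∇u|` at `p`. -/
def gradNorm (u : S → ℝ) (p : S) : ℝ :=
  Real.sqrt (∑ i : Fin m, ∑ j : Fin m, gramInv p i j * coordDeriv u p i * coordDeriv u p j)

/-- `tr (T ∇² u) = T^{ij} ∇_i ∇_j u` at `p`. -/
def traceOp (T : S → Matrix (Fin m) (Fin m) ℝ) (u : S → ℝ) (p : S) : ℝ :=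
  ∑ i, ∑ j, T p i j * hessian u p i j

/-- The Omori-Yau maximum principle on `S` for the trace type operator `tr (T ∇²)`. -/
def OmoriYau (T : S → Matrix (Fin m) (Fin m) ℝ) : Prop :=
  ∀ u : S → ℝ, ContMDiff (𝓡 m) 𝓘(ℝ, ℝ) 2 u → BddAbove (range u) →
    ∃ p : ℕ → S, ∀ i : ℕ, 1 ≤ i →
      (⨆ q, u q) - 1 / (i : ℝ) < u (p i) ∧ gradNorm m u (p i) < 1 / (i : ℝ) ∧
        traceOp T u (p i) < 1 / (i : ℝ)

/-- The symmetric tensor `T` is semi-definite (of either sign) at every point. -/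
def IsSemidefinite (T : S → Matrix (Fin m) (Fin m) ℝ) : Prop :=
  ∀ p, (∀ ξ : Fin m → ℝ, 0 ≤ ∑ i, ∑ j, T p i j * ξ i * ξ j) ∨
    (∀ ξ : Fin m → ℝ, ∑ i, ∑ j, T p i j * ξ i * ξ j ≤ 0)

end Intrinsic

/-! ### The warped product and its hypersurfaces

The warped product manifold `[0, R) ×_lam N`, `0 < R ≤ ∞`, is the subset `[0, R) × N` of
`ℝ × N`. -/

/-- The interval `[0, R)`. -/
def base (R : EReal) : Set ℝ := {t | 0 ≤ t ∧ (t : EReal) < R}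

/-- The derivative of `lam` on `[0, R)` (one-sided at `0`). -/
def warpDeriv (R : EReal) (lam : ℝ → ℝ) (t : ℝ) : ℝ := derivWithin lam (base R) t

/-- The product model for `ℝ × N`. -/
abbrev prodModel (m : ℕ) :
    ModelWithCorners ℝ (ℝ × EuclideanSpace ℝ (Fin m)) (ModelProd ℝ (EuclideanSpace ℝ (Fin m))) :=
  𝓘(ℝ, ℝ).prod (𝓡 m)

section Hypersurface

variable {m : ℕ} {N : Type*} [TopologicalSpace N] [ChartedSpace (EuclideanSpace ℝ (Fin m)) N]

/-- The differential `dr` of the first coordinate `r`. -/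
def dRadial {y : ℝ × N} (v : TangentSpace (prodModel m) y) : ℝ :=
  mfderiv (prodModel m) 𝓘(ℝ, ℝ) (Prod.fst : ℝ × N → ℝ) y v

/-- The differential of the projection to `N`. -/
def dFiber {y : ℝ × N} (v : TangentSpace (prodModel m) y) : TangentSpace (𝓡 m) y.2 :=
  mfderiv (prodModel m) (𝓡 m) (Prod.snd : ℝ × N → N) y v

/-- The vector `∂_r` at `y`. -/
def radial (y : ℝ × N) : TangentSpace (prodModel m) y :=
  mfderiv 𝓘(ℝ, ℝ) (prodModel m) (fun t : ℝ => ((t, y.2) : ℝ × N)) y.1 (1 : ℝ)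

variable [RiemannianBundle (fun x : N => TangentSpace (𝓡 m) x)]

/-- The warped product metric `dr² + lam(r)² g_N`. -/
def warpedMetric (lam : ℝ → ℝ) (y : ℝ × N) (v w : TangentSpace (prodModel m) y) : ℝ :=
  dRadial v * dRadial w + lam y.1 ^ 2 * inner ℝ (dFiber v) (dFiber w)

variable {S : Type*} [TopologicalSpace S] [ChartedSpace (EuclideanSpace ℝ (Fin m)) S]

variable [IsManifold (𝓡 m) ∞ N] in
/-- `ν` is a smooth unit normal field along the hypersurface `f`. -/
structure IsUnitNormal (lam : ℝ → ℝ) (f : S → ℝ × N)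
    (ν : ∀ p, TangentSpace (prodModel m) (f p)) : Prop where
  smooth : ContMDiff (𝓡 m) (prodModel m).tangent ∞
    (fun p => (⟨f p, ν p⟩ : TangentBundle (prodModel m) (ℝ × N)))
  unit : ∀ p, warpedMetric lam (f p) (ν p) (ν p) = 1
  normal : ∀ p (v : TangentSpace (𝓡 m) p),
    warpedMetric lam (f p) (ν p) (mfderiv (𝓡 m) (prodModel m) f p v) = 0

/-- The components `h_{ij} = - ⟨∇_{∂_i} ∂_j, ν⟩ = ⟨∇_{∂_i} ν, ∂_j⟩` at `p` of the second
fundamental form of the hypersurface `f` with respect to `-ν`, where `∇` is the Levi-Civita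
connection of the warped product metric. In the charts at `p` and at `f p`, with `F` the
coordinate expression of `f`, the vector `∇_{∂_i} ∂_j` is
`∂_i ∂_j F + Γ(∂_i F, ∂_j F)`. The coordinates of `ν p` in the preferred chart at `f p` are `ν p`
itself. -/
def secondFF (R : EReal) (lam : ℝ → ℝ) (f : S → ℝ × N)
    (ν : ∀ p, TangentSpace (prodModel m) (f p)) (p : S) : Matrix (Fin m) (Fin m) ℝ :=
  Matrix.of fun i j =>
    let φ := extChartAt (𝓡 m) p
    let ψ := extChartAt (prodModel m) (f p)
    let F : EuclideanSpace ℝ (Fin m) → ℝ × EuclideanSpace ℝ (Fin m) := ψ ∘ f ∘ φ.symm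
    let G := chartForm (prodModel m) (warpedMetric (m := m) (N := N) lam) (f p);
    -(G (ψ (f p)) (fderiv ℝ (fun z => fderiv ℝ F z (stdVec j)) (φ p) (stdVec i)) (ν p)
      + christoffelFirst G (ψ.target ∩ ψ.symm ⁻¹' (base R ×ˢ univ)) (ψ (f p))
          (fderiv ℝ F (φ p) (stdVec i)) (fderiv ℝ F (φ p) (stdVec j)) (ν p))

variable [RiemannianBundle (fun x : S => TangentSpace (𝓡 m) x)]

variable (m) in
/-- `f` is an isometric immersion into `[0, R) ×_lam N`. -/
structure IsIsometricImmersion (R : EReal) (lam : ℝ → ℝ) (f : S → ℝ × N) : Prop where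
  smooth : ContMDiff (𝓡 m) (prodModel m) ∞ f
  mem_base : ∀ p, (f p).1 ∈ base R
  isometric : ∀ p (v w : TangentSpace (𝓡 m) p),
    warpedMetric lam (f p) (mfderiv (𝓡 m) (prodModel m) f p v)
      (mfderiv (𝓡 m) (prodModel m) f p w) = inner ℝ v w

/-- The `(2k+1)`-mean curvature `H_{2k+1} = -2 E_{(k)}^{ij} h_{ij}`. -/
def oddCurvature (R : EReal) (lam : ℝ → ℝ) (f : S → ℝ × N)
    (ν : ∀ p, TangentSpace (prodModel m) (f p)) (k : ℕ) (p : S) : ℝ :=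
  -2 * ∑ i, ∑ j, genEinstein m k p i j * secondFF R lam f ν p i j

end Hypersurface

end

end WarpedProduct

open WarpedProduct

/-! Write θ = ⟨∂_r, ν⟩, μ = λ'/λ, M = m - 2k, and let A = Mμ - H_{2k+1}/H_{2k} ≥ 0 be the defect in
the curvature comparison. Splitting ∂_r into tangential and normal parts gives ∂_r = ∇r + θν, hence
|∇r|² = 1 - θ², and the Gauss formula gives ∇²r = μ(g - dr⊗dr) - θh (`height_function_geometry`).
The trace of -2E_(k) against g is M·H_{2k} (`sum_genEinstein_mul`), so Lr = μ(M·H_{2k} + 2E_(k)(dr,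
dr)) - θ·H_{2k}(Mμ - A).

Semi-definiteness bounds |2E_(k)(dr, dr)| by M·H_{2k}·|∇r|² (`abs_quadratic_le_trace`). Along an
Omori–Yau sequence for r, |∇r| tends to 0, and star-shapedness selects the root θ → 1 of θ² → 1. All
μ-terms in Lr then cancel up to O(|∇r|²), μ being bounded on the slab, and H_{2k} ≥ C₁ leaves A(p_i)
= O(1/i) (`le_of_trace_lt`). Thus inf A ≤ 0, and |∇r| ≤ inf A forces r to be constant.

With r = r₀ constant, the projection Σ → N is isometric up to the factor λ(r₀). Its image is open by
the inverse function theorem and closed because chart segments lift at bounded speed to the complete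
Σ (`exists_mem_of_local_continuation`, `surjective_of_inner_mfderiv_eq`); connectedness of N makes
it onto. -/

namespace WarpedProduct

/-! ### Contractions of the generalized Kronecker delta and trace estimates -/

theorem det_bordered {R : Type*} [CommRing R] {n : ℕ} (M : Matrix (Fin (n + 1)) (Fin (n + 1)) R) :
    M.det = M 0 0 * (M.submatrix Fin.succ Fin.succ).det
      - ∑ b, ∑ a, M 0 b.succ * (M.submatrix Fin.succ Fin.succ).adjugate b a * M a.succ 0 := by
  rw [Matrix.det_succ_row_zero, Fin.sum_univ_succ, sub_eq_add_neg, ← Finset.sum_neg_distrib]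
  congr 1
  · simp
  · refine Finset.sum_congr rfl fun b _ => ?_
    cases n with
    | zero => exact b.elim0
    | succ n =>
      rw [Matrix.det_succ_column_zero, Finset.mul_sum, ← Finset.sum_neg_distrib]
      refine Finset.sum_congr rfl fun a _ => ?_
      rw [Matrix.adjugate_fin_succ_eq_det_submatrix]
      have : ((M.submatrix Fin.succ b.succ.succAbove).submatrix a.succAbove Fin.succ)
          = (M.submatrix Fin.succ Fin.succ).submatrix a.succAbove b.succAbove := by
        ext c d
        simp [Fin.succ_succAbove_succ]
      rw [this]
      simp only [Matrix.submatrix_apply, Fin.val_succ, pow_add, pow_one, Fin.succ_succAbove_zero]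
      ring

/-- The delta with one extra index on each side is a bordered determinant with corner 1. Summing
`det_bordered` over the repeated index gives m · det A from the corner, while the border terms
assemble to tr(adj A · A) = r · det A. -/
theorem sum_genDelta_cons {m r : ℕ} (I J : Fin r → Fin m) :
    ∑ i, genDelta (Fin.cons i I : Fin (r + 1) → Fin m) (Fin.cons i J)
      = ((m : ℝ) - r) * genDelta I J := by
  set A : Matrix (Fin r) (Fin r) ℝ :=
    Matrix.of fun a b : Fin r => if I b = J a then (1 : ℝ) else 0 with hA
  have h1 : ∀ i, genDelta (Fin.cons i I : Fin (r + 1) → Fin m) (Fin.cons i J)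
      = A.det - ∑ b, ∑ a, A.adjugate b a *
        ((if I b = i then 1 else 0) * (if i = J a then 1 else 0)) := by
    intro i
    rw [genDelta, det_bordered]
    have : (Matrix.of fun a b : Fin (r + 1) =>
        if (Fin.cons i I : Fin (r + 1) → Fin m) b = (Fin.cons i J : Fin (r + 1) → Fin m) a
        then (1 : ℝ) else 0).submatrix Fin.succ Fin.succ = A := by
      ext a b
      simp [hA]
    rw [this]
    simp only [Matrix.of_apply, Fin.cons_zero, Fin.cons_succ, if_true, one_mul]
    congr 1
    refine Finset.sum_congr rfl fun b _ => Finset.sum_congr rfl fun a _ => ?_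
    ring
  have h2 : ∀ b a, ∑ i : Fin m, A.adjugate b a *
        ((if I b = i then (1 : ℝ) else 0) * (if i = J a then 1 else 0)) = A.adjugate b a * A a b := by
    intro b a
    rw [← Finset.mul_sum]
    simp [hA]
  have h3 : ∑ b, ∑ a, A.adjugate b a * A a b = r * A.det := by
    have : ∑ b, (A.adjugate * A) b b = r * A.det := by
      rw [Matrix.adjugate_mul]
      simp
    simpa [Matrix.mul_apply] using this
  calc _ = ∑ i : Fin m, (A.det - ∑ b, ∑ a, A.adjugate b a *
        ((if I b = i then 1 else 0) * (if i = J a then 1 else 0))) :=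
        Finset.sum_congr rfl fun i _ => h1 i
    _ = m * A.det - ∑ b, ∑ a, A.adjugate b a * A a b := by
        rw [Finset.sum_sub_distrib, Finset.sum_comm]
        congr 1
        · simp
        · refine Finset.sum_congr rfl fun b _ => ?_
          rw [Finset.sum_comm]
          exact Finset.sum_congr rfl fun a _ => h2 b a
    _ = _ := by
        rw [h3, genDelta]
        ring

open scoped MatrixOrder Matrix.Norms.L2Operator in
/-- The quadratic form of a positive semidefinite `T` is controlled by its trace against `g`. -/
theorem quadratic_le_trace {m : ℕ} (T g : Matrix (Fin m) (Fin m) ℝ) (ξ : Fin m → ℝ) (c : ℝ)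
    (hT : ∀ v : Fin m → ℝ, 0 ≤ ∑ i, ∑ j, T i j * v i * v j)
    (hg : ∀ i j, g i j = g j i)
    (hξ : ∀ v : Fin m → ℝ, (∑ i, ξ i * v i) ^ 2 ≤ c * ∑ i, ∑ j, g i j * v i * v j) :
    ∑ i, ∑ j, T i j * ξ i * ξ j ≤ c * ∑ i, ∑ j, T i j * g i j := by
  -- `T` need not be symmetric, but its symmetric part has the same pairing with every symmetric
  -- array, in particular with `g` and with ξ ⊗ ξ.
  set P : Matrix (Fin m) (Fin m) ℝ := Matrix.of fun i j => (T i j + T j i) / 2 with hP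
  have sym : ∀ w : Fin m → Fin m → ℝ, (∀ i j, w i j = w j i) →
      ∑ i, ∑ j, P i j * w i j = ∑ i, ∑ j, T i j * w i j := by
    intro w hw
    have e1 : ∑ i, ∑ j, T j i * w i j = ∑ i, ∑ j, T i j * w i j := by
      rw [Finset.sum_comm]
      exact Finset.sum_congr rfl fun i _ => Finset.sum_congr rfl fun j _ => by rw [hw j i]
    have e2 : ∑ i, ∑ j, P i j * w i j
        = (∑ i, ∑ j, T i j * w i j + ∑ i, ∑ j, T j i * w i j) / 2 := by
      simp only [← Finset.sum_add_distrib, Finset.sum_div]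
      exact Finset.sum_congr rfl fun i _ => Finset.sum_congr rfl fun j _ => by
        simp only [hP, Matrix.of_apply]; ring
    rw [e2, e1]; ring
  have hPP : P.PosSemidef := by
    refine Matrix.PosSemidef.of_dotProduct_mulVec_nonneg ?_ fun v => ?_
    · ext i j
      simp [hP, add_comm]
    · have := sym (fun i j => v i * v j) fun i j => mul_comm _ _
      have h2 : star v ⬝ᵥ P.mulVec v = ∑ i, ∑ j, P i j * (v i * v j) := by
        simp only [dotProduct, Matrix.mulVec, Finset.mul_sum, Pi.star_apply, star_trivial]
        exact Finset.sum_congr rfl fun i _ => Finset.sum_congr rfl fun j _ => by ring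
      rw [h2, this]
      simpa [mul_assoc] using hT v
  -- With P = BᵀB both sides become sums over the rows of `B`, and the claim is `hξ` applied row by
  -- row.
  obtain ⟨B, hB⟩ := CStarAlgebra.nonneg_iff_eq_star_mul_self.mp hPP.nonneg
  have hBij : ∀ i j, P i j = ∑ a, B a i * B a j := by
    intro i j
    rw [hB]
    simp [Matrix.mul_apply, Matrix.star_eq_conjTranspose]
  have push : ∀ w : Fin m → Fin m → ℝ,
      ∑ i, ∑ j, P i j * w i j = ∑ a, ∑ i, ∑ j, w i j * B a i * B a j := by
    intro w
    simp only [hBij, Finset.sum_mul]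
    rw [Finset.sum_comm' (t' := Finset.univ) (s' := fun _ => Finset.univ) (by simp)]
    rw [Finset.sum_comm]
    have : ∀ j, ∑ i, ∑ a, B a i * B a j * w i j = ∑ a, ∑ i, w i j * B a i * B a j := by
      intro j
      rw [Finset.sum_comm]
      exact Finset.sum_congr rfl fun i _ => Finset.sum_congr rfl fun j _ => by ring
    rw [Finset.sum_comm]
    simp only [this]
    rw [Finset.sum_comm]
    refine Finset.sum_congr rfl fun a _ => ?_
    rw [Finset.sum_comm]
  have e1 := sym (fun i j => ξ i * ξ j) fun i j => mul_comm _ _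
  have e2 := sym g hg
  simp only [mul_assoc] at e1 ⊢
  rw [← e1, ← e2, push fun i j => ξ i * ξ j, push fun i j => g i j, Finset.mul_sum]
  refine Finset.sum_le_sum fun a _ => ?_
  refine le_trans (le_of_eq ?_) (hξ (B a))
  rw [sq, Finset.sum_mul_sum]
  exact Finset.sum_congr rfl fun i _ => Finset.sum_congr rfl fun j _ => by ring

section
variable {m : ℕ} {S : Type*} [TopologicalSpace S] [ChartedSpace (EuclideanSpace ℝ (Fin m)) S]
variable [RiemannianBundle (fun x : S => TangentSpace (𝓡 m) x)]

/-- The trace identity -2E_(k)^{ij} g_{ij} = (m - 2k) H_{2k}: contraction with `g` undoes the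
raising by `gramInv`, and the repeated index that remains is summed by `sum_genDelta_cons`. -/
theorem sum_genEinstein_mul (k : ℕ) (p : S) (g : Matrix (Fin m) (Fin m) ℝ)
    (hg : ∀ l i, ∑ j, gramInv p l j * g i j = if l = i then 1 else 0) :
    -2 * ∑ i, ∑ j, genEinstein m k p i j * g i j = ((m : ℝ) - 2 * k) * gaussBonnet m k p := by
  have h1 : ∀ i, ∑ j, genEinstein m k p i j * g i j
      = -(1 / 2 ^ (k + 1)) * ∑ I : Fin (2 * k) → Fin m, ∑ J : Fin (2 * k) → Fin m,
      genDelta (Fin.cons i I : Fin (2 * k + 1) → Fin m) (Fin.cons i J) * curvatureProd k p I J := by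
    intro i
    set D : Fin m → ℝ := fun l => ∑ I : Fin (2 * k) → Fin m, ∑ J : Fin (2 * k) → Fin m,
      genDelta (Fin.cons i I : Fin (2 * k + 1) → Fin m) (Fin.cons l J) * curvatureProd k p I J
    have : ∀ j, genEinstein m k p i j * g i j
        = ∑ l, -(1 / 2 ^ (k + 1)) * D l * (gramInv p l j * g i j) := by
      intro j
      simp only [genEinstein, Matrix.of_apply, Finset.mul_sum (s := Finset.univ (α := Fin m)), Finset.sum_mul]
      exact Finset.sum_congr rfl fun l _ => by simp only [D]; ring
    simp only [this]
    rw [Finset.sum_comm]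
    simp only [← Finset.mul_sum, hg]
    simp [D]
  simp only [h1, ← Finset.mul_sum]
  rw [Finset.sum_comm]
  have h2 : ∀ I : Fin (2 * k) → Fin m, ∑ i, ∑ J : Fin (2 * k) → Fin m,
      genDelta (Fin.cons i I : Fin (2 * k + 1) → Fin m) (Fin.cons i J) * curvatureProd k p I J
      = ((m : ℝ) - 2 * k) * ∑ J, genDelta I J * curvatureProd k p I J := by
    intro I
    rw [Finset.sum_comm, Finset.mul_sum]
    refine Finset.sum_congr rfl fun J _ => ?_
    rw [← Finset.sum_mul, sum_genDelta_cons]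
    push_cast
    ring
  simp only [h2, ← Finset.mul_sum, gaussBonnet, pow_succ]
  field_simp
end

/-! ### Christoffel symbols under pullback and for warped metrics -/

section Calculus
set_option synthInstance.maxHeartbeats 400000
set_option maxHeartbeats 1000000
open scoped Topology
open Filter

variable {V W : Type*} [NormedAddCommGroup V] [NormedSpace ℝ V]
  [NormedAddCommGroup W] [NormedSpace ℝ W]

/-- At r = 0 the ambient metric has only one-sided derivatives. A map staying in the domain
nevertheless pulls it back to something differentiable in the ordinary sense. -/
theorem hasFDerivAt_comp_of_eventually_mem {Z : Type*} [NormedAddCommGroup Z] [NormedSpace ℝ Z]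
    {B : V → Z} {s : Set V} {F : W → V} {x : W} {F' : W →L[ℝ] V}
    (hB : DifferentiableWithinAt ℝ B s (F x)) (hF : HasFDerivAt F F' x)
    (hFs : ∀ᶠ z in 𝓝 x, F z ∈ s) :
    HasFDerivAt (fun z => B (F z)) ((fderivWithin ℝ B s (F x)).comp F') x := by
  have : HasFDerivWithinAt (B ∘ F) ((fderivWithin ℝ B s (F x)).comp F') (F ⁻¹' s) x :=
    hB.hasFDerivWithinAt.comp x hF.hasFDerivWithinAt (mapsTo_preimage F s)
  exact this.hasFDerivAt hFs

theorem hasFDerivWithinAt_comp_snd {Z : Type*} [NormedAddCommGroup Z] [NormedSpace ℝ Z]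
    {b : W → Z} {s : Set (V × W)} {y : V × W} (hb : DifferentiableAt ℝ b y.2) :
    HasFDerivWithinAt (fun z : V × W => b z.2)
      ((fderiv ℝ b y.2).comp (ContinuousLinearMap.snd ℝ V W)) s y :=
  hb.hasFDerivAt.comp_hasFDerivWithinAt y hasFDerivWithinAt_snd

theorem differentiableWithinAt_const_add_sq_smul {Z : Type*} [NormedAddCommGroup Z]
    [NormedSpace ℝ Z] {a : Z} {c : V → ℝ} {h : V → Z} {s : Set V} {y : V}
    (hc : DifferentiableWithinAt ℝ c s y) (hh : DifferentiableWithinAt ℝ h s y) :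
    DifferentiableWithinAt ℝ (fun z => a + c z ^ 2 • h z) s y :=
  (differentiableWithinAt_const _).add ((hc.pow 2).smul hh)

theorem christoffelFirst_congr {G G' : V → V → V → ℝ} {s : Set V} {y : V} (hy : y ∈ s)
    (h : ∀ᶠ z in 𝓝[s] y, ∀ v w, G z v w = G' z v w) (u v w : V) :
    christoffelFirst G s y u v w = christoffelFirst G' s y u v w := by
  have key : ∀ v w, fderivWithin ℝ (fun z => G z v w) s y = fderivWithin ℝ (fun z => G' z v w) s y :=
    fun v w => EventuallyEq.fderivWithin_eq_of_mem (h.mono fun z hz => hz v w) hy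
  simp only [christoffelFirst, key]

theorem fderivWithin_clm_apply₂ {B : V → W →L[ℝ] W →L[ℝ] ℝ} {s : Set V} {y : V}
    (hB : DifferentiableWithinAt ℝ B s y) (hs : UniqueDiffWithinAt ℝ s y) (v w : W) (u : V) :
    fderivWithin ℝ (fun z => B z v w) s y u = fderivWithin ℝ B s y u v w := by
  have h1 := (hB.hasFDerivWithinAt.clm_apply (hasFDerivWithinAt_const v y s)).clm_apply
    (hasFDerivWithinAt_const w y s)
  rw [h1.fderivWithin hs]
  simp

/-- Linearity in the last slot allows ∇r, and then the splitting ∂_r = ∇r + θν, to be inserted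
there. -/
theorem christoffelFirst_add_smul {B : V → V →L[ℝ] V →L[ℝ] ℝ} {s : Set V} {y : V}
    (hB : DifferentiableWithinAt ℝ B s y) (hs : UniqueDiffWithinAt ℝ s y) (u v w w' : V) (c : ℝ) :
    christoffelFirst (fun z v w => B z v w) s y u v (w + c • w')
      = christoffelFirst (fun z v w => B z v w) s y u v w
        + c * christoffelFirst (fun z v w => B z v w) s y u v w' := by
  simp only [christoffelFirst, fderivWithin_clm_apply₂ hB hs]
  simp only [map_add, map_smul,
    add_apply, smul_apply, smul_eq_mul]
  ring

theorem christoffelFirst_sum {ι : Type*} (t : Finset ι) {B : V → V →L[ℝ] V →L[ℝ] ℝ} {s : Set V}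
    {y : V} (hB : DifferentiableWithinAt ℝ B s y) (hs : UniqueDiffWithinAt ℝ s y) (u v : V)
    (c : ι → ℝ) (w : ι → V) :
    christoffelFirst (fun z v w => B z v w) s y u v (∑ a ∈ t, c a • w a)
      = ∑ a ∈ t, c a * christoffelFirst (fun z v w => B z v w) s y u v (w a) := by
  classical
  induction t using Finset.induction_on with
  | empty => simp [christoffelFirst, fderivWithin_clm_apply₂ hB hs]
  | insert a t ha ih =>
    rw [Finset.sum_insert ha, Finset.sum_insert ha, add_comm, christoffelFirst_add_smul hB hs, ih,
      add_comm]

variable {B : V → V →L[ℝ] V →L[ℝ] ℝ} {s : Set V} {F : W → V} {x : W}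

theorem hasFDerivAt_pullback (hB : DifferentiableWithinAt ℝ B s (F x))
    (hF : ContDiffAt ℝ 2 F x) (hFs : ∀ᶠ z in 𝓝 x, F z ∈ s) (v w u : W) :
    DifferentiableAt ℝ (fun z => B (F z) (fderiv ℝ F z v) (fderiv ℝ F z w)) x ∧
    fderiv ℝ (fun z => B (F z) (fderiv ℝ F z v) (fderiv ℝ F z w)) x u
      = fderivWithin ℝ B s (F x) (fderiv ℝ F x u) (fderiv ℝ F x v) (fderiv ℝ F x w)
        + B (F x) (fderiv ℝ (fderiv ℝ F) x u v) (fderiv ℝ F x w)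
        + B (F x) (fderiv ℝ F x v) (fderiv ℝ (fderiv ℝ F) x u w) := by
  have hF1 : HasFDerivAt F (fderiv ℝ F x) x := (hF.differentiableAt (by norm_num)).hasFDerivAt
  have hF2 : HasFDerivAt (fderiv ℝ F) (fderiv ℝ (fderiv ℝ F) x) x :=
    ((hF.fderiv_right (m := 1) (by norm_num)).differentiableAt (by norm_num)).hasFDerivAt
  have hBF : HasFDerivAt (fun z => B (F z)) ((fderivWithin ℝ B s (F x)).comp (fderiv ℝ F x)) x :=
    hasFDerivAt_comp_of_eventually_mem (Z := V →L[ℝ] V →L[ℝ] ℝ) (B := B) hB hF1 hFs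
  have h := (hBF.clm_apply (hF2.clm_apply (hasFDerivAt_const v x))).clm_apply
    (hF2.clm_apply (hasFDerivAt_const w x))
  refine ⟨h.differentiableAt, ?_⟩
  rw [h.fderiv]
  simp
  ring

/-- The Gauss formula before splitting off the normal part. In the Koszul expression the symmetry of
D²F cancels all second-order terms except two equal ones, ½ · 2⟨D²F(u, v), DF w⟩. -/
theorem christoffelFirst_pullback (hB : DifferentiableWithinAt ℝ B s (F x))
    (hs : UniqueDiffWithinAt ℝ s (F x))
    (hsymm : ∀ v w, B (F x) v w = B (F x) w v)
    (hF : ContDiffAt ℝ 2 F x) (hFs : ∀ᶠ z in 𝓝 x, F z ∈ s) (u v w : W) :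
    christoffelFirst (fun z v w => B (F z) (fderiv ℝ F z v) (fderiv ℝ F z w)) univ x u v w
      = B (F x) (fderiv ℝ (fderiv ℝ F) x u v) (fderiv ℝ F x w)
        + christoffelFirst (fun z v w => B z v w) s (F x)
            (fderiv ℝ F x u) (fderiv ℝ F x v) (fderiv ℝ F x w) := by
  have hsym : ∀ a b, fderiv ℝ (fderiv ℝ F) x a b = fderiv ℝ (fderiv ℝ F) x b a :=
    fun a b => (hF.isSymmSndFDerivAt (by simp)).eq a b
  simp only [christoffelFirst, fderivWithin_clm_apply₂ hB hs, fderivWithin_univ,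
    (hasFDerivAt_pullback hB hF hFs _ _ _).2]
  rw [hsym v u, hsym w u, hsym w v,
    hsymm (fderiv ℝ F x u) (fderiv ℝ (fderiv ℝ F) x v w),
    hsymm (fderiv ℝ F x v) (fderiv ℝ (fderiv ℝ F) x u w)]
  ring

/-- The bilinear form `dr² + c² b` on `ℝ × W`. -/
noncomputable def warpedForm (c : ℝ) (b : W →L[ℝ] W →L[ℝ] ℝ) : ℝ × W →L[ℝ] ℝ × W →L[ℝ] ℝ :=
  (ContinuousLinearMap.mul ℝ ℝ).bilinearComp (ContinuousLinearMap.fst ℝ ℝ W)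
      (ContinuousLinearMap.fst ℝ ℝ W)
    + c ^ 2 • b.bilinearComp (ContinuousLinearMap.snd ℝ ℝ W) (ContinuousLinearMap.snd ℝ ℝ W)

theorem warpedForm_apply (c : ℝ) (b : W →L[ℝ] W →L[ℝ] ℝ) (v w : ℝ × W) :
    warpedForm c b v w = v.1 * w.1 + c ^ 2 * b v.2 w.2 := by
  simp [warpedForm]

variable {b : W → W →L[ℝ] W →L[ℝ] ℝ} {lam : ℝ → ℝ} {l' : ℝ} {J : Set ℝ} {s : Set (ℝ × W)}
  {y : ℝ × W}

theorem differentiableWithinAt_warpedForm 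
    (hb : DifferentiableAt ℝ b y.2) (hlam : HasDerivWithinAt lam l' J y.1)
    (hsJ : ∀ z ∈ s, z.1 ∈ J) :
    DifferentiableWithinAt ℝ (fun z : ℝ × W => warpedForm (lam z.1) (b z.2)) s y := by
  have h1 : DifferentiableWithinAt ℝ (fun z : ℝ × W => lam z.1) s y :=
    hlam.differentiableWithinAt.comp y differentiableWithinAt_fst hsJ
  have h2 : DifferentiableWithinAt ℝ (fun z : ℝ × W => b z.2) s y :=
    (hasFDerivWithinAt_comp_snd (Z := W →L[ℝ] W →L[ℝ] ℝ) (b := b) hb).differentiableWithinAt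
  have h3 : DifferentiableWithinAt ℝ (fun z : ℝ × W =>
      (b z.2).bilinearComp (ContinuousLinearMap.snd ℝ ℝ W) (ContinuousLinearMap.snd ℝ ℝ W)) s y := by
    have e : ∀ z : ℝ × W,
        (b z.2).bilinearComp (ContinuousLinearMap.snd ℝ ℝ W) (ContinuousLinearMap.snd ℝ ℝ W)
        = ((ContinuousLinearMap.compL ℝ (ℝ × W) W ℝ).flip (ContinuousLinearMap.snd ℝ ℝ W)).comp
          ((b z.2).comp (ContinuousLinearMap.snd ℝ ℝ W)) := by
      intro z
      ext <;> simp
    simp only [e]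
    exact (differentiableWithinAt_const _).clm_comp (h2.clm_comp (differentiableWithinAt_const _))
  exact differentiableWithinAt_const_add_sq_smul (Z := ℝ × W →L[ℝ] ℝ × W →L[ℝ] ℝ) h1 h3

/-- Pairing with ∂_r is v ↦ v.1, constant in the base point, so only -½ ∂_r of the metric survives.
This is the ambient Hessian of r up to sign. -/
theorem christoffelFirst_warpedForm_radial 
    (hb : DifferentiableAt ℝ b y.2) (hlam : HasDerivWithinAt lam l' J y.1)
    (hsJ : ∀ z ∈ s, z.1 ∈ J) (hs : UniqueDiffWithinAt ℝ s y) (u v : ℝ × W) :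
    christoffelFirst (fun z v w => warpedForm (lam z.1) (b z.2) v w) s y u v (1, 0)
      = -(lam y.1 * l' * b y.2 u.2 v.2) := by
  have h0 : ∀ v : ℝ × W, fderivWithin ℝ (fun z : ℝ × W => warpedForm (lam z.1) (b z.2) v (1, 0)) s y
      = 0 := by
    intro v
    simp [warpedForm_apply]
  have h1 : HasFDerivWithinAt (fun z : ℝ × W => lam z.1)
      ((ContinuousLinearMap.toSpanSingleton ℝ l').comp (ContinuousLinearMap.fst ℝ ℝ W)) s y :=
    hlam.hasFDerivWithinAt.comp y hasFDerivWithinAt_fst hsJ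
  have h2 : HasFDerivWithinAt (fun z : ℝ × W => b z.2)
      ((fderiv ℝ b y.2).comp (ContinuousLinearMap.snd ℝ ℝ W)) s y :=
    hasFDerivWithinAt_comp_snd (Z := W →L[ℝ] W →L[ℝ] ℝ) (b := b) hb
  have h3 := ((h1.pow 2).mul ((h2.clm_apply (hasFDerivWithinAt_const u.2 y s)).clm_apply
    (hasFDerivWithinAt_const v.2 y s))).const_add (u.1 * v.1)
  have h4 : fderivWithin ℝ (fun z : ℝ × W => warpedForm (lam z.1) (b z.2) u v) s y (1, 0)
      = 2 * lam y.1 * l' * b y.2 u.2 v.2 := by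
    have e : (fun z : ℝ × W => warpedForm (lam z.1) (b z.2) u v)
      = fun z : ℝ × W => u.1 * v.1 + lam z.1 ^ 2 * b z.2 u.2 v.2 := by
      funext z
      rw [warpedForm_apply]
    rw [e]
    erw [h3.fderivWithin hs]
    simp
    ring
  simp only [christoffelFirst, h0, h4, zero_apply]
  ring

end Calculus
-- Inverse charts and their differentials
section Charts
open scoped Topology
open Filter

variable {V : Type*} [NormedAddCommGroup V] [NormedSpace ℝ V]
    {H : Type*} [TopologicalSpace H] {I : ModelWithCorners ℝ V H} [I.Boundaryless]
    {M : Type*} [TopologicalSpace M] [ChartedSpace H M]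

theorem mdifferentiableAt_extChartAt_symm_of_mem [IsManifold I 1 M] {p : M} {z : V}
    (hz : z ∈ (extChartAt I p).target) :
    MDifferentiableAt 𝓘(ℝ, V) I (extChartAt I p).symm z := by
  have := mdifferentiableWithinAt_extChartAt_symm (I := I) hz
  rwa [I.range_eq_univ, mdifferentiableWithinAt_univ] at this

/-- The tangent space at `p` is identified with the model space through the preferred chart at `p`,
so the differential of the inverse chart there is the identity. -/
theorem mfderiv_extChartAt_symm_self [IsManifold I 1 M] (p : M) (v : V) :
    (mfderiv 𝓘(ℝ, V) I (extChartAt I p).symm (extChartAt I p p) v : V) = v := by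
  have := mfderivWithin_range_extChartAt_symm (I := I) (x := p)
  rw [I.range_eq_univ, mfderivWithin_univ] at this
  exact congrArg (fun L : V →L[ℝ] V => L v) this

theorem contMDiffOn_mfderiv_extChartAt_symm [IsManifold I ∞ M] (p : M) (v : V) :
    ContMDiffOn 𝓘(ℝ, V) I.tangent ∞
      (fun z => (⟨(extChartAt I p).symm z, mfderiv 𝓘(ℝ, V) I (extChartAt I p).symm z v⟩ :
        TangentBundle I M)) (extChartAt I p).target := by
  have hopen := isOpen_extChartAt_target (I := I) p
  have h1 := (contMDiffOn_extChartAt_symm (I := I) (n := ∞) p).contMDiffOn_tangentMapWithin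
    (m := ∞) (by simp) hopen.uniqueMDiffOn
  have h2 : ContMDiff 𝓘(ℝ, V) 𝓘(ℝ, V).tangent ∞
      (fun z : V => (⟨z, v⟩ : TangentBundle 𝓘(ℝ, V) V)) :=
    contMDiff_vectorSpace_iff_contDiff.2 contDiff_const
  refine (h1.comp h2.contMDiffOn (t := π V (TangentSpace 𝓘(ℝ, V)) ⁻¹' (extChartAt I p).target)
    fun z hz => hz).congr fun z hz => ?_
  simp only [Function.comp_apply, tangentMapWithin]
  rw [mfderivWithin_of_mem_nhds (hopen.mem_nhds hz)]

end Charts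

/-! ### The Riemannian metric as a differentiable field of bilinear forms -/

section Riemannian
open scoped Topology
open Filter
variable {m : ℕ} {N : Type*} [TopologicalSpace N] [ChartedSpace (EuclideanSpace ℝ (Fin m)) N]
    [IsManifold (𝓡 m) ∞ N]
    [RiemannianBundle (fun x : N => TangentSpace (𝓡 m) x)]

omit [IsManifold (𝓡 m) ∞ N] in
theorem inner_tangentSpace_congr {a b : N} (h : a = b) (v w : EuclideanSpace ℝ (Fin m)) :
    inner ℝ (show TangentSpace (𝓡 m) a from v) (show TangentSpace (𝓡 m) a from w)
      = inner ℝ (show TangentSpace (𝓡 m) b from v) (show TangentSpace (𝓡 m) b from w) := by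
  subst h
  rfl

theorem chartMetric_self (p : N) (v w : EuclideanSpace ℝ (Fin m)) :
    chartMetric p (extChartAt (𝓡 m) p p) v w
      = inner ℝ (show TangentSpace (𝓡 m) p from v) (show TangentSpace (𝓡 m) p from w) := by
  have : IsManifold (𝓡 m) 1 N := IsManifold.of_le (n := ∞) (by simp)
  have h := inner_tangentSpace_congr (m := m) (extChartAt_to_inv (I := 𝓡 m) p) v w
  rw [← h, chartMetric, chartForm]
  congr 1
  · exact mfderiv_extChartAt_symm_self (I := 𝓡 m) p v
  · exact mfderiv_extChartAt_symm_self (I := 𝓡 m) p w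

/-- Bilinearity holds at every coordinate point, even outside the chart target, so the equality is
unconditional; only differentiability is restricted to the target. -/
theorem exists_chartMetric_eq [IsContMDiffRiemannianBundle (𝓡 m) ∞ (EuclideanSpace ℝ (Fin m))
      (fun x : N => TangentSpace (𝓡 m) x)] (p : N) :
    ∃ b : EuclideanSpace ℝ (Fin m) →
        EuclideanSpace ℝ (Fin m) →L[ℝ] EuclideanSpace ℝ (Fin m) →L[ℝ] ℝ,
      (∀ z v w, chartMetric p z v w = b z v w) ∧
      (∀ z ∈ (extChartAt (𝓡 m) p).target, DifferentiableAt ℝ b z) ∧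
      (∀ z v w, b z v w = b z w v) ∧ (∀ z v, 0 ≤ b z v v) := by
  have h1 : ∀ v w, ContDiffOn ℝ ∞ (fun z => chartMetric p z v w) (extChartAt (𝓡 m) p).target := by
    intro v w
    rw [← contMDiffOn_iff_contDiffOn]
    exact (contMDiffOn_mfderiv_extChartAt_symm (I := 𝓡 m) p v).inner_bundle
      (contMDiffOn_mfderiv_extChartAt_symm (I := 𝓡 m) p w)
  let A := fun z => mfderiv 𝓘(ℝ, EuclideanSpace ℝ (Fin m)) (𝓡 m) (extChartAt (𝓡 m) p).symm z
  let b := fun z : EuclideanSpace ℝ (Fin m) => (LinearMap.mk₂ ℝ (chartMetric (S := N) p z)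
    (fun v v' w => (congrArg (fun a => inner ℝ a (A z w)) ((A z).map_add v v')).trans
      (inner_add_left _ _ _))
    (fun c v w => (congrArg (fun a => inner ℝ a (A z w)) ((A z).map_smul c v)).trans
      (real_inner_smul_left _ _ _))
    (fun v w w' => (congrArg (fun a => inner ℝ (A z v) a) ((A z).map_add w w')).trans
      (inner_add_right _ _ _))
    (fun c v w => (congrArg (fun a => inner ℝ (A z v) a) ((A z).map_smul c w)).trans
      (real_inner_smul_right _ _ _))).toContinuousBilinearMap
  have hb : ∀ z v w, chartMetric p z v w = b z v w := fun z v w => rfl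
  refine ⟨b, hb, ?_, fun z v w => ?_, fun z v => ?_⟩
  · have : ContDiffOn ℝ ∞ b (extChartAt (𝓡 m) p).target := by
      rw [contDiffOn_clm_apply]
      intro v
      rw [contDiffOn_clm_apply]
      intro w
      exact h1 v w
    intro z hz
    exact (this.contDiffAt ((isOpen_extChartAt_target p).mem_nhds hz)).differentiableAt (by simp)
  · rw [← hb, ← hb]
    exact real_inner_comm _ _
  · rw [← hb]
    exact real_inner_self_nonneg

end Riemannian
-- The warped metric in product charts
section WarpedCharts
open scoped Topology
open Filter
variable {m : ℕ} {N : Type*} [TopologicalSpace N] [ChartedSpace (EuclideanSpace ℝ (Fin m)) N]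

variable {X : Type*} [NormedAddCommGroup X] [NormedSpace ℝ X]
    {K : Type*} [TopologicalSpace K] {J : ModelWithCorners ℝ X K}
    {Y : Type*} [TopologicalSpace Y] [ChartedSpace K Y]

theorem dRadial_mfderiv {c : Y → ℝ × N} {x : Y} (hc : MDifferentiableAt J (prodModel m) c x)
    (v : TangentSpace J x) :
    dRadial (mfderiv J (prodModel m) c x v) = mfderiv J 𝓘(ℝ, ℝ) (fun z => (c z).1) x v := by
  have := mfderiv_comp_apply (I := J) (I' := prodModel m) (I'' := 𝓘(ℝ, ℝ)) x
    (g := (Prod.fst : ℝ × N → ℝ)) (f := c) mdifferentiableAt_fst hc v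
  exact this.symm

theorem dFiber_mfderiv {c : Y → ℝ × N} {x : Y} (hc : MDifferentiableAt J (prodModel m) c x)
    (v : TangentSpace J x) :
    dFiber (mfderiv J (prodModel m) c x v) = mfderiv J (𝓡 m) (fun z => (c z).2) x v := by
  have := mfderiv_comp_apply (I := J) (I' := prodModel m) (I'' := 𝓡 m) x
    (g := (Prod.snd : ℝ × N → N)) (f := c) mdifferentiableAt_snd hc v
  exact this.symm

theorem dRadial_apply {y : ℝ × N} (v : TangentSpace (prodModel m) y) :
    dRadial v = (show ℝ × EuclideanSpace ℝ (Fin m) from v).1 := by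
  rw [dRadial, mfderiv_fst]
  rfl

theorem dFiber_apply {y : ℝ × N} (v : TangentSpace (prodModel m) y) :
    dFiber v = (show ℝ × EuclideanSpace ℝ (Fin m) from v).2 := by
  rw [dFiber, mfderiv_snd]
  rfl

theorem extChartAt_prodModel_symm (q : ℝ × N) (y : ℝ × EuclideanSpace ℝ (Fin m)) :
    (extChartAt (prodModel m) q).symm y = (y.1, (extChartAt (𝓡 m) q.2).symm y.2) := by
  rw [extChartAt_prod]
  simp [chartAt_self_eq]

theorem extChartAt_prodModel_apply (q y : ℝ × N) :
    extChartAt (prodModel m) q y = (y.1, extChartAt (𝓡 m) q.2 y.2) := by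
  rw [extChartAt_prod]
  simp [chartAt_self_eq]

theorem extChartAt_prodModel_target (q : ℝ × N) :
    (extChartAt (prodModel m) q).target = univ ×ˢ (extChartAt (𝓡 m) q.2).target := by
  rw [extChartAt_prod]
  simp [chartAt_self_eq]

theorem radial_apply (y : ℝ × N) :
    (show ℝ × EuclideanSpace ℝ (Fin m) from radial (m := m) y) = (1, 0) := by
  have h1 : MDifferentiableAt 𝓘(ℝ, ℝ) (prodModel m) (fun t : ℝ => ((t, y.2) : ℝ × N)) y.1 :=
    mdifferentiableAt_id.prodMk mdifferentiableAt_const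
  refine Prod.ext ?_ ?_
  · rw [← dRadial_apply (y := y)]
    refine (dRadial_mfderiv h1 _).trans ?_
    change mfderiv 𝓘(ℝ, ℝ) 𝓘(ℝ, ℝ) (id : ℝ → ℝ) y.1 (1 : ℝ) = 1
    rw [mfderiv_id]
    rfl
  · rw [← dFiber_apply (y := y)]
    refine (dFiber_mfderiv h1 _).trans ?_
    change mfderiv 𝓘(ℝ, ℝ) (𝓡 m) (fun _ : ℝ => y.2) y.1 (1 : ℝ) = 0
    rw [mfderiv_const]
    rfl

variable [RiemannianBundle (fun x : N => TangentSpace (𝓡 m) x)]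

theorem warpedMetric_congr (lam : ℝ → ℝ) {a b : ℝ × N} (h : a = b)
    {v w v' w' : ℝ × EuclideanSpace ℝ (Fin m)} (hv : v = v') (hw : w = w') :
    warpedMetric (m := m) lam a v w = warpedMetric (m := m) lam b v' w' := by
  subst h hv hw
  rfl

theorem chartForm_warpedMetric [IsManifold (𝓡 m) ∞ N] (lam : ℝ → ℝ) (q : ℝ × N)
    {y : ℝ × EuclideanSpace ℝ (Fin m)} (hy : y ∈ (extChartAt (prodModel m) q).target)
    (v w : ℝ × EuclideanSpace ℝ (Fin m)) :
    chartForm (prodModel m) (warpedMetric (m := m) (N := N) lam) q y v w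
      = v.1 * w.1 + lam y.1 ^ 2 * chartMetric q.2 y.2 v.2 w.2 := by
  have : IsManifold (𝓡 m) 1 N := IsManifold.of_le (n := ∞) (by simp)
  have hy2 : y.2 ∈ (extChartAt (𝓡 m) q.2).target := by
    rw [extChartAt_prodModel_target] at hy
    exact hy.2
  have hd : MDifferentiableAt 𝓘(ℝ, ℝ × EuclideanSpace ℝ (Fin m)) (prodModel m)
      (extChartAt (prodModel m) q).symm y := mdifferentiableAt_extChartAt_symm_of_mem hy
  have hr : ∀ v : ℝ × EuclideanSpace ℝ (Fin m), dRadial (mfderiv 𝓘(ℝ, ℝ × EuclideanSpace ℝ (Fin m))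
      (prodModel m) (extChartAt (prodModel m) q).symm y v) = v.1 := by
    intro v
    have e : (fun z => ((extChartAt (prodModel m) q).symm z).1) = Prod.fst :=
      funext fun z => congrArg Prod.fst (extChartAt_prodModel_symm q z)
    refine (dRadial_mfderiv hd v).trans ?_
    rw [e, mfderiv_eq_fderiv, fderiv_fst]
    rfl
  have hs : ∀ v : ℝ × EuclideanSpace ℝ (Fin m),
      (dFiber (mfderiv 𝓘(ℝ, ℝ × EuclideanSpace ℝ (Fin m))
      (prodModel m) (extChartAt (prodModel m) q).symm y v) : EuclideanSpace ℝ (Fin m))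
      = mfderiv 𝓘(ℝ, EuclideanSpace ℝ (Fin m)) (𝓡 m) (extChartAt (𝓡 m) q.2).symm y.2 v.2 := by
    intro v
    have e : (fun z => ((extChartAt (prodModel m) q).symm z).2)
        = (extChartAt (𝓡 m) q.2).symm ∘ Prod.snd :=
      funext fun z => congrArg Prod.snd (extChartAt_prodModel_symm q z)
    refine (dFiber_mfderiv hd v).trans ?_
    refine (congrArg (fun c : ℝ × EuclideanSpace ℝ (Fin m) → N =>
      (mfderiv 𝓘(ℝ, ℝ × EuclideanSpace ℝ (Fin m)) (𝓡 m) c y v : EuclideanSpace ℝ (Fin m))) e).trans ?_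
    have := mfderiv_comp_apply (I := 𝓘(ℝ, ℝ × EuclideanSpace ℝ (Fin m)))
      (I' := 𝓘(ℝ, EuclideanSpace ℝ (Fin m))) (I'' := 𝓡 m) y
      (g := (extChartAt (𝓡 m) q.2).symm) (f := Prod.snd)
      (mdifferentiableAt_extChartAt_symm_of_mem hy2)
      differentiableAt_snd.mdifferentiableAt v
    refine this.trans ?_
    rw [mfderiv_eq_fderiv, fderiv_snd]
    rfl
  have hpt : ((extChartAt (prodModel m) q).symm y).2 = (extChartAt (𝓡 m) q.2).symm y.2 := by
    rw [extChartAt_prodModel_symm]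
  have hpt1 : ((extChartAt (prodModel m) q).symm y).1 = y.1 := by
    rw [extChartAt_prodModel_symm]
  rw [chartForm, warpedMetric, hpt1]
  refine congrArg₂ (· + ·) (congrArg₂ (· * ·) (hr v) (hr w)) (congrArg (lam y.1 ^ 2 * ·) ?_)
  refine Eq.trans ?_ (inner_tangentSpace_congr (m := m) hpt _ _)
  congr 1
  · exact hs v
  · exact hs w

theorem chartForm_warpedMetric_self [IsManifold (𝓡 m) ∞ N] (lam : ℝ → ℝ) (q : ℝ × N)
    (v w : ℝ × EuclideanSpace ℝ (Fin m)) :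
    chartForm (prodModel m) (warpedMetric (m := m) (N := N) lam) q (extChartAt (prodModel m) q q) v w
      = warpedMetric (m := m) lam q v w := by
  have : IsManifold (𝓡 m) 1 N := IsManifold.of_le (n := ∞) (by simp)
  exact warpedMetric_congr lam (extChartAt_to_inv (I := prodModel m) q)
    (mfderiv_extChartAt_symm_self (I := prodModel m) q v)
    (mfderiv_extChartAt_symm_self (I := prodModel m) q w)

end WarpedCharts
-- Coordinate expression of the hypersurface and its induced metric
section Immersion
open scoped Topology
open Filter
variable {m : ℕ} {N : Type*} [TopologicalSpace N] [ChartedSpace (EuclideanSpace ℝ (Fin m)) N]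
  {S : Type*} [TopologicalSpace S] [ChartedSpace (EuclideanSpace ℝ (Fin m)) S]

/-- The coordinate expression of `f` in the preferred charts at `p` and `f p`. -/
noncomputable def chartMap (f : S → ℝ × N) (p : S) :
    EuclideanSpace ℝ (Fin m) → ℝ × EuclideanSpace ℝ (Fin m) :=
  extChartAt (prodModel m) (f p) ∘ f ∘ (extChartAt (𝓡 m) p).symm

/-- The domain of the coordinate expression of the warped metric around `q`. -/
def chartDomain (R : EReal) (q : ℝ × N) : Set (ℝ × EuclideanSpace ℝ (Fin m)) :=
  (extChartAt (prodModel m) q).target ∩ (extChartAt (prodModel m) q).symm ⁻¹' (base R ×ˢ univ)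

theorem chartDomain_eq (R : EReal) (q : ℝ × N) :
    chartDomain (m := m) R q = base R ×ˢ (extChartAt (𝓡 m) q.2).target := by
  ext y
  rw [chartDomain, extChartAt_prodModel_target]
  simp only [mem_inter_iff, mem_prod, mem_preimage, extChartAt_prodModel_symm, mem_univ]
  tauto

theorem base_convex (R : EReal) : Convex ℝ (base R) := by
  refine Set.OrdConnected.convex ⟨fun a ha b hb c hc => ⟨ha.1.trans hc.1, lt_of_le_of_lt ?_ hb.2⟩⟩
  exact_mod_cast hc.2

/-- Makes one-sided derivatives at r = 0 unique: a convex set with nonempty interior has unique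
derivatives. -/
theorem uniqueDiffOn_base {R : EReal} (hR : 0 < R) : UniqueDiffOn ℝ (base R) := by
  refine uniqueDiffOn_convex (base_convex R) ?_
  obtain ⟨c, hc0, hcR⟩ := EReal.lt_iff_exists_real_btwn.1 hR
  have hc : (0 : ℝ) < c := by exact_mod_cast hc0
  have hsub : Ioo 0 c ⊆ base R := fun t ht =>
    ⟨ht.1.le, lt_trans (by exact_mod_cast ht.2) hcR⟩
  exact ⟨c / 2, interior_mono hsub (by rw [interior_Ioo]; constructor <;> linarith)⟩

theorem uniqueDiffOn_chartDomain {R : EReal} (hR : 0 < R) (q : ℝ × N) :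
    UniqueDiffOn ℝ (chartDomain (m := m) R q) := by
  rw [chartDomain_eq]
  exact (uniqueDiffOn_base hR).prod (isOpen_extChartAt_target q.2).uniqueDiffOn

theorem chartMap_apply (f : S → ℝ × N) (p : S) (z : EuclideanSpace ℝ (Fin m)) :
    chartMap f p z = ((f ((extChartAt (𝓡 m) p).symm z)).1,
      extChartAt (𝓡 m) (f p).2 (f ((extChartAt (𝓡 m) p).symm z)).2) := by
  simp only [chartMap, Function.comp_apply, extChartAt_prodModel_apply]

theorem chartMap_self (f : S → ℝ × N) (p : S) :
    chartMap f p (extChartAt (𝓡 m) p p) = extChartAt (prodModel m) (f p) (f p) := by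
  simp only [chartMap, Function.comp_apply, extChartAt_to_inv]

variable {R : EReal} {lam : ℝ → ℝ} {f : S → ℝ × N}

theorem contDiffAt_chartMap (hf : ContMDiff (𝓡 m) (prodModel m) ∞ f) (p : S) :
    ContDiffAt ℝ ∞ (chartMap f p) (extChartAt (𝓡 m) p p) := by
  have := (contMDiffAt_iff.1 (hf p)).2
  rwa [(𝓡 m).range_eq_univ, contDiffWithinAt_univ] at this

theorem eventually_mem_source (hf : Continuous f) (p : S) :
    ∀ᶠ z in 𝓝 (extChartAt (𝓡 m) p p), z ∈ (extChartAt (𝓡 m) p).target ∧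
      f ((extChartAt (𝓡 m) p).symm z) ∈ (extChartAt (prodModel m) (f p)).source := by
  refine Filter.Eventually.and (extChartAt_target_mem_nhds (I := 𝓡 m) p) ?_
  have h1 : ContinuousAt (fun z => f ((extChartAt (𝓡 m) p).symm z)) (extChartAt (𝓡 m) p p) :=
    hf.continuousAt.comp (continuousAt_extChartAt_symm p)
  refine h1.preimage_mem_nhds ?_
  rw [extChartAt_to_inv]
  exact extChartAt_source_mem_nhds (f p)

variable [RiemannianBundle (fun x : N => TangentSpace (𝓡 m) x)]
  [RiemannianBundle (fun x : S => TangentSpace (𝓡 m) x)]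

theorem eventually_chartMap_mem (hf : IsIsometricImmersion m R lam f) (p : S) :
    ∀ᶠ z in 𝓝 (extChartAt (𝓡 m) p p), chartMap f p z ∈ chartDomain (m := m) R (f p) := by
  filter_upwards [eventually_mem_source (m := m) hf.smooth.continuous p] with z hz
  refine ⟨(extChartAt (prodModel m) (f p)).map_source hz.2, ?_⟩
  simp only [chartMap, Function.comp_apply, mem_preimage]
  rw [(extChartAt (prodModel m) (f p)).left_inv hz.2]
  exact ⟨hf.mem_base _, mem_univ _⟩

/-- The isometry condition is needed on a whole neighbourhood of the coordinate point, because
Christoffel symbols differentiate it. -/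
theorem eventually_chartMetric_eq [IsManifold (𝓡 m) ∞ N] [IsManifold (𝓡 m) ∞ S]
    (hf : IsIsometricImmersion m R lam f) (p : S) :
    ∀ᶠ z in 𝓝 (extChartAt (𝓡 m) p p), ∀ v w, chartMetric p z v w =
      chartForm (prodModel m) (warpedMetric (m := m) (N := N) lam) (f p) (chartMap f p z)
        (fderiv ℝ (chartMap f p) z v) (fderiv ℝ (chartMap f p) z w) := by
  have i1 : IsManifold (𝓡 m) 1 S := IsManifold.of_le (n := ∞) (by simp)
  have i2 : IsManifold (𝓡 m) 1 N := IsManifold.of_le (n := ∞) (by simp)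
  have h0 := eventually_mem_source (m := m) hf.smooth.continuous p
  have h1 : ∀ᶠ z in 𝓝 (extChartAt (𝓡 m) p p), ContDiffAt ℝ 1 (chartMap f p) z :=
    ((contDiffAt_chartMap hf.smooth p).of_le (by simp)).eventually (by simp)
  filter_upwards [h0, h0.eventually_nhds, h1] with z hz hz' hz1 v w
  have hF : MDifferentiableAt 𝓘(ℝ, EuclideanSpace ℝ (Fin m)) 𝓘(ℝ, ℝ × EuclideanSpace ℝ (Fin m))
      (chartMap f p) z := (hz1.differentiableAt (by simp)).mdifferentiableAt
  have hψ : MDifferentiableAt 𝓘(ℝ, ℝ × EuclideanSpace ℝ (Fin m)) (prodModel m)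
      (extChartAt (prodModel m) (f p)).symm (chartMap f p z) :=
    mdifferentiableAt_extChartAt_symm_of_mem ((extChartAt (prodModel m) (f p)).map_source hz.2)
  have hφ : MDifferentiableAt 𝓘(ℝ, EuclideanSpace ℝ (Fin m)) (𝓡 m)
      (extChartAt (𝓡 m) p).symm z := mdifferentiableAt_extChartAt_symm_of_mem hz.1
  have hfd : MDifferentiableAt (𝓡 m) (prodModel m) f ((extChartAt (𝓡 m) p).symm z) :=
    (hf.smooth _).mdifferentiableAt (by simp)
  have e : (extChartAt (prodModel m) (f p)).symm ∘ chartMap f p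
      =ᶠ[𝓝 z] f ∘ (extChartAt (𝓡 m) p).symm := by
    filter_upwards [hz'] with z' h
    exact (extChartAt (prodModel m) (f p)).left_inv h.2
  have key : ∀ v : EuclideanSpace ℝ (Fin m),
      (mfderiv 𝓘(ℝ, ℝ × EuclideanSpace ℝ (Fin m)) (prodModel m)
        (extChartAt (prodModel m) (f p)).symm (chartMap f p z) (fderiv ℝ (chartMap f p) z v) :
        ℝ × EuclideanSpace ℝ (Fin m))
      = mfderiv (𝓡 m) (prodModel m) f ((extChartAt (𝓡 m) p).symm z)
        (mfderiv 𝓘(ℝ, EuclideanSpace ℝ (Fin m)) (𝓡 m) (extChartAt (𝓡 m) p).symm z v) := by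
    intro v
    have e1 := mfderiv_comp_apply z hψ hF v
    have e2 := mfderiv_comp_apply z hfd hφ v
    rw [mfderiv_eq_fderiv] at e1
    refine e1.symm.trans (Eq.trans ?_ e2)
    have e3 := e.mfderiv_eq (I := 𝓘(ℝ, EuclideanSpace ℝ (Fin m))) (I' := prodModel m)
    exact congrArg (fun L : EuclideanSpace ℝ (Fin m) →L[ℝ] ℝ × EuclideanSpace ℝ (Fin m) => L v) e3
  have hiso := hf.isometric ((extChartAt (𝓡 m) p).symm z)
    (mfderiv 𝓘(ℝ, EuclideanSpace ℝ (Fin m)) (𝓡 m) (extChartAt (𝓡 m) p).symm z v)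
    (mfderiv 𝓘(ℝ, EuclideanSpace ℝ (Fin m)) (𝓡 m) (extChartAt (𝓡 m) p).symm z w)
  refine hiso.symm.trans ?_
  exact warpedMetric_congr lam e.self_of_nhds.symm (key v).symm (key w).symm

end Immersion

/-! ### Splitting ∂_r along the hypersurface -/

section LinearAlgebra

/-- The map (x, s) ↦ Dx + sν satisfies B(T, T) = g(x, x) + s², so it is injective and, by dimension,
onto. The difference of the two sides is orthogonal to its image, hence to itself. -/
theorem radial_decomposition {E : Type*} [NormedAddCommGroup E] [NormedSpace ℝ E]
    [FiniteDimensional ℝ E] (B : ℝ × E →L[ℝ] ℝ × E →L[ℝ] ℝ) (g : E →L[ℝ] E →L[ℝ] ℝ)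
    (D : E →L[ℝ] ℝ × E) (ν : ℝ × E) (hsymm : ∀ v w, B v w = B w v)
    (hB : ∀ w, B w w = 0 → w = 0) (hg : ∀ v, 0 ≤ g v v) (hg0 : ∀ v, g v v = 0 → v = 0)
    (hiso : ∀ v w, B (D v) (D w) = g v w) (hν : B ν ν = 1) (hνD : ∀ v, B ν (D v) = 0)
    (hrad : ∀ w, B (1, 0) w = w.1) (ρ : E) (hρ : ∀ v, g ρ v = (D v).1) :
    (1, 0) = D ρ + ν.1 • ν := by
  let T : E × ℝ →ₗ[ℝ] ℝ × E :=
    D.toLinearMap.coprod (LinearMap.toSpanSingleton ℝ (ℝ × E) ν)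
  have hT : ∀ x : E × ℝ, T x = D x.1 + x.2 • ν := fun x => by simp [T]
  have hinj : Function.Injective T := by
    rw [injective_iff_map_eq_zero]
    intro x hx
    have h : B (T x) (T x) = g x.1 x.1 + x.2 ^ 2 := by
      rw [hT]
      simp only [map_add, map_smul, add_apply, smul_apply, smul_eq_mul, hiso, hν, hνD,
        hsymm (D x.1) ν]
      ring
    rw [hx] at h
    simp only [map_zero] at h
    have h1 := hg x.1
    have h2 : x.2 = 0 := by nlinarith [sq_nonneg x.2]
    have h3 : x.1 = 0 := hg0 _ (by nlinarith [sq_nonneg x.2])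
    exact Prod.ext h3 h2
  have hsurj : Function.Surjective T := by
    refine (LinearMap.injective_iff_surjective_of_finrank_eq_finrank ?_).1 hinj
    simp [Module.finrank_prod, add_comm]
  have horth : ∀ x, B ((1, 0) - (D ρ + ν.1 • ν)) (T x) = 0 := by
    intro x
    rw [hT]
    simp only [map_add, map_sub, map_smul, add_apply, sub_apply, smul_apply, smul_eq_mul, hiso, hν,
      hνD, hrad, hρ, hsymm (D ρ) ν]
    ring
  obtain ⟨x, hx⟩ := hsurj ((1, 0) - (D ρ + ν.1 • ν))
  have h := horth x
  rw [hx] at h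
  exact sub_eq_zero.1 (hB _ h)

end LinearAlgebra
-- The Gram matrix and its inverse
section Gram
variable {m : ℕ} {S : Type*} [TopologicalSpace S] [ChartedSpace (EuclideanSpace ℝ (Fin m)) S]
  [IsManifold (𝓡 m) ∞ S] [RiemannianBundle (fun x : S => TangentSpace (𝓡 m) x)]

theorem sum_smul_stdVec (v : EuclideanSpace ℝ (Fin m)) : ∑ i, v i • stdVec i = v := by
  ext j
  simp [stdVec, Pi.single_apply]

theorem bilin_eq_sum (B : EuclideanSpace ℝ (Fin m) →L[ℝ] EuclideanSpace ℝ (Fin m) →L[ℝ] ℝ)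
    (v w : EuclideanSpace ℝ (Fin m)) :
    B v w = ∑ i, ∑ j, B (stdVec i) (stdVec j) * v i * w j := by
  conv_lhs => rw [← sum_smul_stdVec v, ← sum_smul_stdVec w]
  simp only [map_sum, map_smul, sum_apply, smul_apply, smul_eq_mul,
    Finset.mul_sum]
  rw [Finset.sum_comm]
  exact Finset.sum_congr rfl fun i _ => Finset.sum_congr rfl fun j _ => by ring

theorem chartMetric_self_pos (p : S) (v : EuclideanSpace ℝ (Fin m))
    (h : chartMetric p (extChartAt (𝓡 m) p p) v v = 0) : v = 0 := by
  rw [chartMetric_self] at h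
  exact (inner_self_eq_zero (𝕜 := ℝ) (E := TangentSpace (𝓡 m) p)).1 h

variable [IsContMDiffRiemannianBundle (𝓡 m) ∞ (EuclideanSpace ℝ (Fin m))
  (fun x : S => TangentSpace (𝓡 m) x)]

theorem gram_symm (p : S) (y : EuclideanSpace ℝ (Fin m)) (i j : Fin m) :
    gram p y i j = gram p y j i := by
  obtain ⟨b, hb, -, hsymm, -⟩ := exists_chartMetric_eq (m := m) p
  simp only [gram, Matrix.of_apply, hb]
  exact hsymm _ _ _

theorem gram_posDef (p : S) : (gram p (extChartAt (𝓡 m) p p)).PosDef := by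
  obtain ⟨b, hb, -, hsymm, hpos⟩ := exists_chartMetric_eq (m := m) p
  refine Matrix.PosDef.of_dotProduct_mulVec_pos ?_ fun v hv => ?_
  · ext i j
    exact gram_symm p _ j i
  · have e : star v ⬝ᵥ (gram p (extChartAt (𝓡 m) p p)).mulVec v
        = b (extChartAt (𝓡 m) p p) (WithLp.toLp 2 v) (WithLp.toLp 2 v) := by
      rw [bilin_eq_sum]
      simp only [dotProduct, Matrix.mulVec, Finset.mul_sum, Pi.star_apply, star_trivial, gram,
        Matrix.of_apply, hb]
      exact Finset.sum_congr rfl fun i _ => Finset.sum_congr rfl fun j _ => by ring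
    rw [e]
    refine lt_of_le_of_ne (hpos _ _) fun h => hv ?_
    have := chartMetric_self_pos p (WithLp.toLp 2 v) ((hb _ _ _).trans h.symm)
    simpa using this

theorem gramInv_symm (p : S) (i j : Fin m) : gramInv p i j = gramInv p j i := by
  have h : (gramInv p).IsHermitian := (gram_posDef (m := m) p).isHermitian.inv
  simpa using h.apply j i

theorem sum_gramInv_mul_gram (p : S) (l i : Fin m) :
    ∑ j, gramInv p l j * gram p (extChartAt (𝓡 m) p p) i j = if l = i then 1 else 0 := by
  have h : gramInv p * gram p (extChartAt (𝓡 m) p p) = 1 :=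
    Matrix.nonsing_inv_mul _ ((gram_posDef (m := m) p).det_pos.ne'.isUnit)
  have := congrFun (congrFun h l) i
  rw [Matrix.mul_apply, Matrix.one_apply] at this
  rw [← this]
  exact Finset.sum_congr rfl fun j _ => by rw [gram_symm p _ i j]

end Gram

/-! ### Gradient and Hessian of the height function -/

section Hessian
set_option synthInstance.maxHeartbeats 400000
set_option maxHeartbeats 1000000
open scoped Topology
open Filter
variable {m : ℕ} {N : Type*} [TopologicalSpace N] [ChartedSpace (EuclideanSpace ℝ (Fin m)) N]
  {S : Type*} [TopologicalSpace S] [ChartedSpace (EuclideanSpace ℝ (Fin m)) S]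
  {R : EReal} {lam : ℝ → ℝ} {f : S → ℝ × N}

theorem hasFDerivAt_chartMap_fst (hf : ContMDiff (𝓡 m) (prodModel m) ∞ f) (p : S) :
    ∀ᶠ z in 𝓝 (extChartAt (𝓡 m) p p), ∀ v,
      fderiv ℝ ((fun q => (f q).1) ∘ (extChartAt (𝓡 m) p).symm) z v
        = (fderiv ℝ (chartMap f p) z v).1 := by
  have h1 : ∀ᶠ z in 𝓝 (extChartAt (𝓡 m) p p), ContDiffAt ℝ 1 (chartMap f p) z :=
    ((contDiffAt_chartMap hf p).of_le (by simp)).eventually (by simp)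
  filter_upwards [h1] with z hz v
  have e : (fun q => (f q).1) ∘ (extChartAt (𝓡 m) p).symm = fun z => (chartMap f p z).1 := by
    funext z
    rw [chartMap_apply]
    rfl
  rw [e, (hz.differentiableAt (by simp)).hasFDerivAt.fst.fderiv]
  rfl

theorem coordDeriv_height (hf : ContMDiff (𝓡 m) (prodModel m) ∞ f) (p : S) (i : Fin m) :
    coordDeriv (fun q => (f q).1) p i
      = (fderiv ℝ (chartMap f p) (extChartAt (𝓡 m) p p) (stdVec i)).1 :=
  (hasFDerivAt_chartMap_fst hf p).self_of_nhds _

theorem hasFDerivAt_fderiv_chartMap (hf : ContMDiff (𝓡 m) (prodModel m) ∞ f) (p : S) :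
    HasFDerivAt (fderiv ℝ (chartMap f p))
      (fderiv ℝ (fderiv ℝ (chartMap f p)) (extChartAt (𝓡 m) p p)) (extChartAt (𝓡 m) p p) :=
  (((contDiffAt_chartMap hf p).fderiv_right (m := 1) (by norm_cast)).differentiableAt
    (by simp)).hasFDerivAt

theorem fderiv_fderiv_chartMap_apply (hf : ContMDiff (𝓡 m) (prodModel m) ∞ f) (p : S)
    (u v : EuclideanSpace ℝ (Fin m)) :
    fderiv ℝ (fun z => fderiv ℝ (chartMap f p) z v) (extChartAt (𝓡 m) p p) u
      = fderiv ℝ (fderiv ℝ (chartMap f p)) (extChartAt (𝓡 m) p p) u v := by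
  rw [((hasFDerivAt_fderiv_chartMap hf p).clm_apply (hasFDerivAt_const v _)).fderiv]
  simp

theorem fderiv_fderiv_height (hf : ContMDiff (𝓡 m) (prodModel m) ∞ f) (p : S)
    (u v : EuclideanSpace ℝ (Fin m)) :
    fderiv ℝ (fun z => fderiv ℝ ((fun q => (f q).1) ∘ (extChartAt (𝓡 m) p).symm) z v)
        (extChartAt (𝓡 m) p p) u
      = (fderiv ℝ (fderiv ℝ (chartMap f p)) (extChartAt (𝓡 m) p p) u v).1 := by
  have e : (fun z => fderiv ℝ ((fun q => (f q).1) ∘ (extChartAt (𝓡 m) p).symm) z v)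
      =ᶠ[𝓝 (extChartAt (𝓡 m) p p)] fun z => (fderiv ℝ (chartMap f p) z v).1 :=
    (hasFDerivAt_chartMap_fst hf p).mono fun z hz => hz v
  rw [e.fderiv_eq,
    (((hasFDerivAt_fderiv_chartMap hf p).clm_apply (hasFDerivAt_const v _)).fst).fderiv]
  simp

/-- The gradient of the height function and the Hessian of the height function, for a hypersurface
of a warped product. -/
theorem height_function_geometry [IsManifold (𝓡 m) ∞ N] [IsManifold (𝓡 m) ∞ S]
    [RiemannianBundle (fun x : N => TangentSpace (𝓡 m) x)]
    [IsContMDiffRiemannianBundle (𝓡 m) ∞ (EuclideanSpace ℝ (Fin m))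
      (fun x : N => TangentSpace (𝓡 m) x)]
    [RiemannianBundle (fun x : S => TangentSpace (𝓡 m) x)]
    [IsContMDiffRiemannianBundle (𝓡 m) ∞ (EuclideanSpace ℝ (Fin m))
      (fun x : S => TangentSpace (𝓡 m) x)]
    (hR : 0 < R) (hlam : ContDiffOn ℝ ∞ lam (base R)) (hlam_pos : ∀ t ∈ base R, 0 < lam t)
    (hf : IsIsometricImmersion m R lam f) (ν : ∀ p, TangentSpace (prodModel m) (f p))
    (hν : IsUnitNormal lam f ν) (p : S) :
    let r : Fin m → ℝ := coordDeriv (fun q => (f q).1) p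
    let g := gram p (extChartAt (𝓡 m) p p)
    let θ := warpedMetric lam (f p) (radial (f p)) (ν p)
    (∀ i j, hessian (fun q => (f q).1) p i j
      = warpDeriv R lam (f p).1 / lam (f p).1 * (g i j - r i * r j)
        - θ * secondFF R lam f ν p i j) ∧
    (∑ i, ∑ j, gramInv p i j * r i * r j = 1 - θ ^ 2) ∧ 0 ≤ 1 - θ ^ 2 ∧
    (∀ v : Fin m → ℝ, (∑ i, r i * v i) ^ 2 ≤ (1 - θ ^ 2) * ∑ i, ∑ j, g i j * v i * v j) := by
  intro r g θ
  obtain ⟨b, hb, hbdiff, hbsymm, hbpos⟩ := exists_chartMetric_eq (m := m) (f p).2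
  obtain ⟨bS, hbS, -, hbSsymm, hbSpos⟩ := exists_chartMetric_eq (m := m) p
  set x := extChartAt (𝓡 m) p p with hx
  set F := chartMap (m := m) f p with hF
  have hFx : F x = extChartAt (prodModel m) (f p) (f p) := chartMap_self (m := m) f p
  have hFx1 : (F x).1 = (f p).1 := by rw [hFx, extChartAt_prodModel_apply]
  have hFx2 : (F x).2 = extChartAt (𝓡 m) (f p).2 (f p).2 := by rw [hFx, extChartAt_prodModel_apply]
  set s := chartDomain (m := m) R (f p) with hs
  let B : ℝ × EuclideanSpace ℝ (Fin m) →
      ℝ × EuclideanSpace ℝ (Fin m) →L[ℝ] ℝ × EuclideanSpace ℝ (Fin m) →L[ℝ] ℝ :=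
    fun y => warpedForm (lam y.1) (b y.2)
  let G := chartForm (prodModel m) (warpedMetric (m := m) (N := N) lam) (f p)
  have hGB : ∀ y ∈ s, ∀ v w, G y v w = B y v w := by
    intro y hy v w
    simp only [G, B]
    rw [chartForm_warpedMetric lam (f p) hy.1, warpedForm_apply, hb]
  have hFs : ∀ᶠ z in 𝓝 x, F z ∈ s := eventually_chartMap_mem hf p
  have hFxs : F x ∈ s := hFs.self_of_nhds
  have huniq : UniqueDiffWithinAt ℝ s (F x) := uniqueDiffOn_chartDomain hR (f p) _ hFxs
  have hsJ : ∀ z ∈ s, z.1 ∈ base R := by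
    intro z hz
    rw [hs, chartDomain_eq] at hz
    exact hz.1
  have hder : HasDerivWithinAt lam (warpDeriv R lam (f p).1) (base R) (F x).1 := by
    rw [hFx1]
    exact ((hlam _ (hf.mem_base p)).differentiableWithinAt (by simp)).hasDerivWithinAt
  have hbx : DifferentiableAt ℝ b (F x).2 := by
    rw [hFx2]
    exact hbdiff _ (mem_extChartAt_target _)
  have hBdiff : DifferentiableWithinAt ℝ B s (F x) :=
    differentiableWithinAt_warpedForm hbx hder hsJ
  have hBsymm : ∀ v w, B (F x) v w = B (F x) w v := by
    intro v w
    simp only [B, warpedForm_apply]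
    rw [hbsymm, mul_comm v.1]
  have hC : ContDiffAt ℝ 2 F x := (contDiffAt_chartMap hf.smooth p).of_le (by norm_cast)
  have hmetric : ∀ᶠ z in 𝓝 x, ∀ v w,
      chartMetric p z v w = B (F z) (fderiv ℝ F z v) (fderiv ℝ F z w) := by
    filter_upwards [eventually_chartMetric_eq hf p, hFs] with z h1 h2 v w
    rw [h1 v w]
    exact hGB _ h2 _ _
  set D := fderiv ℝ F x with hD
  set D2 := fderiv ℝ (fderiv ℝ F) x with hD2
  have hiso : ∀ v w, B (F x) (D v) (D w) = bS x v w := by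
    intro v w
    rw [← hbS, hmetric.self_of_nhds v w]
  have hchr : ∀ u v w, christoffelFirst (chartMetric p) univ x u v w
      = B (F x) (D2 u v) (D w)
        + christoffelFirst (fun z v w => B z v w) s (F x) (D u) (D v) (D w) := by
    intro u v w
    rw [← christoffelFirst_pullback hBdiff huniq hBsymm hC hFs]
    exact christoffelFirst_congr (mem_univ _) (by rwa [nhdsWithin_univ]) u v w
  have hlp : 0 < lam (f p).1 := hlam_pos _ (hf.mem_base p)
  have hrad : ∀ w, B (F x) (1, 0) w = w.1 := by
    intro w
    simp [B, warpedForm_apply]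
  let n : ℝ × EuclideanSpace ℝ (Fin m) := ν p
  have hGself : ∀ v w, B (F x) v w = warpedMetric (m := m) lam (f p) v w := by
    intro v w
    rw [← hGB _ hFxs]
    simp only [G]
    rw [hFx]
    exact chartForm_warpedMetric_self lam (f p) v w
  have hθ : θ = n.1 := by
    rw [← hrad n, hGself]
    exact warpedMetric_congr lam rfl (radial_apply (f p)) rfl
  have hbxpos : ∀ w, b (F x).2 w w = 0 → w = 0 := by
    intro w hw
    rw [hFx2, ← hb] at hw
    exact chartMetric_self_pos _ w hw
  have hBpos : ∀ w, B (F x) w w = 0 → w = 0 := by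
    intro w hw
    simp only [B, warpedForm_apply] at hw
    have h1 := hbpos (F x).2 w.2
    have h2 : 0 < lam (F x).1 ^ 2 := by rw [hFx1]; positivity
    have h3 : 0 ≤ lam (F x).1 ^ 2 * b (F x).2 w.2 w.2 := mul_nonneg h2.le h1
    have h4 : w.1 = 0 := by nlinarith [mul_self_nonneg w.1]
    have h5 : lam (F x).1 ^ 2 * b (F x).2 w.2 w.2 = 0 := by nlinarith [mul_self_nonneg w.1]
    exact Prod.ext h4 (hbxpos _ ((mul_eq_zero.1 h5).resolve_left h2.ne'))
  have hnn : B (F x) n n = 1 := by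
    rw [hGself]
    exact hν.unit p
  have hDf : ∀ v, D v = mfderiv (𝓡 m) (prodModel m) f p v := by
    intro v
    rw [((hf.smooth p).mdifferentiableAt (by simp)).mfderiv, (𝓡 m).range_eq_univ, fderivWithin_univ]
    rfl
  have hnD : ∀ v, B (F x) n (D v) = 0 := by
    intro v
    rw [hGself]
    exact (warpedMetric_congr lam rfl rfl (hDf v)).trans (hν.normal p v)
  have hr : ∀ i, r i = (D (stdVec i)).1 := coordDeriv_height hf.smooth p
  -- `ρ` is ∇r in coordinates: the index of `r` raised by `gramInv`.
  let ρ : EuclideanSpace ℝ (Fin m) := WithLp.toLp 2 fun a => ∑ c, gramInv p a c * r c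
  have hρi : ∀ a, ρ a = ∑ c, gramInv p a c * r c := fun a => rfl
  have hDsum : ∀ v, D v = ∑ j, v j • D (stdVec j) := by
    intro v
    conv_lhs => rw [← sum_smul_stdVec v]
    simp only [map_sum, map_smul]
  have hDv : ∀ v, (D v).1 = ∑ j, r j * v j := by
    intro v
    rw [hDsum, Prod.fst_sum]
    exact Finset.sum_congr rfl fun j _ => by simp [hr, mul_comm]
  have hgb : ∀ i j, g i j = bS x (stdVec i) (stdVec j) := fun i j => hbS x _ _
  have hρ : ∀ v, bS x ρ v = (D v).1 := by
    intro v
    rw [hDv, bilin_eq_sum, Finset.sum_comm]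
    refine Finset.sum_congr rfl fun j _ => ?_
    rw [← Finset.sum_mul]
    congr 1
    simp only [hρi, ← hgb, Finset.mul_sum]
    rw [Finset.sum_comm]
    have : ∀ c, ∑ i, g i j * (gramInv p i c * r c) = (if c = j then 1 else 0) * r c := by
      intro c
      rw [← sum_gramInv_mul_gram p c j, Finset.sum_mul]
      refine Finset.sum_congr rfl fun i _ => ?_
      rw [gramInv_symm p i c, ← gram_symm p _ i j]
      ring
    simp [this]
  have hdec : (1, 0) = D ρ + n.1 • n :=
    radial_decomposition (B (F x)) (bS x) D n hBsymm hBpos (hbSpos x)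
      (fun v hv => chartMetric_self_pos p v ((hbS _ _ _).trans hv)) hiso hnn hnD hrad ρ hρ
  -- The radial component of ∂_r = ∇r + θν reads 1 = |∇r|² + θ².
  have hρρ : (D ρ).1 = 1 - θ ^ 2 := by
    have := congrArg Prod.fst hdec
    simp only [Prod.fst_add, Prod.smul_fst, smul_eq_mul] at this
    rw [hθ]
    linarith
  refine ⟨fun i j => ?_, ?_, ?_, fun v => ?_⟩
  -- Γ^a_{ij} r_a is the first-kind symbol evaluated on ∇r. Replacing ∇r by ∂_r - θν, here and in
  -- ⟨D²F, ∂_r⟩, cancels the ⟨D²F, ∇r⟩ terms and leaves the radial symbol and -θh.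
  · have hΓ : ∑ a, christoffel p x a i j * r a
        = B (F x) (D2 (stdVec i) (stdVec j)) (D ρ)
          + christoffelFirst (fun z v w => B z v w) s (F x) (D (stdVec i)) (D (stdVec j)) (D ρ) := by
      have h1 : ∑ a, christoffel p x a i j * r a
          = ∑ l, ρ l * christoffelFirst (chartMetric p) univ x (stdVec i) (stdVec j) (stdVec l) := by
        simp only [christoffel, hρi, Finset.sum_mul]
        rw [Finset.sum_comm]
        refine Finset.sum_congr rfl fun l _ => Finset.sum_congr rfl fun a _ => ?_
        rw [gramInv_symm p l a]
        change gramInv p a l * _ * r a = _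
        ring
      rw [h1, hDsum ρ, christoffelFirst_sum _ hBdiff huniq, map_sum, ← Finset.sum_add_distrib]
      refine Finset.sum_congr rfl fun l _ => ?_
      rw [hchr, map_smul, smul_eq_mul]
      ring
    have hrd := christoffelFirst_warpedForm_radial (s := s) hbx hder hsJ huniq
      (D (stdVec i)) (D (stdVec j))
    have hlin := christoffelFirst_add_smul hBdiff huniq (D (stdVec i)) (D (stdVec j)) (D ρ) n n.1
    rw [← hdec] at hlin
    have h2 := hrad (D2 (stdVec i) (stdVec j))
    rw [hdec, hBsymm, map_add, map_smul, smul_eq_mul] at h2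
    have hg : g i j - r i * r j
        = lam (f p).1 ^ 2 * b (F x).2 (D (stdVec i)).2 (D (stdVec j)).2 := by
      rw [hgb, ← hiso, hr, hr, ← hFx1]
      simp only [B, warpedForm_apply]
      ring
    have hsec : secondFF R lam f ν p i j = -(B (F x) (D2 (stdVec i) (stdVec j)) n
        + christoffelFirst (fun z v w => B z v w) s (F x) (D (stdVec i)) (D (stdVec j)) n) := by
      have hc := christoffelFirst_congr hFxs (s := s) (eventually_mem_nhdsWithin.mono hGB)
        (D (stdVec i)) (D (stdVec j)) n
      rw [← hc, ← hGB _ hFxs, hFx, ← fderiv_fderiv_chartMap_apply hf.smooth]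
      rfl
    have hhess : hessian (fun q => (f q).1) p i j = (D2 (stdVec i) (stdVec j)).1
        - ∑ a, christoffel p x a i j * r a := by
      rw [← fderiv_fderiv_height hf.smooth]
      rfl
    have hrd' : christoffelFirst (fun z v w => B z v w) s (F x) (D (stdVec i)) (D (stdVec j)) (1, 0)
        = -(lam (f p).1 * warpDeriv R lam (f p).1
          * b (F x).2 (D (stdVec i)).2 (D (stdVec j)).2) := by
      exact hrd.trans (by rw [hFx1])
    rw [hhess, hΓ, hsec, hg, hθ]
    have hmu : warpDeriv R lam (f p).1 / lam (f p).1
          * (lam (f p).1 ^ 2 * b (F x).2 (D (stdVec i)).2 (D (stdVec j)).2)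
        = lam (f p).1 * warpDeriv R lam (f p).1
          * b (F x).2 (D (stdVec i)).2 (D (stdVec j)).2 := by
      field_simp
    rw [hmu]
    linarith
  · rw [← hρρ, hDv]
    refine Finset.sum_congr rfl fun i _ => ?_
    rw [hρi, Finset.mul_sum]
    exact Finset.sum_congr rfl fun j _ => by ring
  · rw [← hρρ, ← hρ]
    exact hbSpos x ρ
  · let v' : EuclideanSpace ℝ (Fin m) := WithLp.toLp 2 v
    have hcs : bS x ρ v' * bS x ρ v' ≤ bS x ρ ρ * bS x v' v' := by
      simp only [← hbS]
      exact real_inner_mul_inner_self_le _ _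
    have h1 : bS x ρ v' = ∑ i, r i * v i := by
      rw [hρ, hDv]
    have h2 : bS x v' v' = ∑ i, ∑ j, g i j * v i * v j := by
      rw [bilin_eq_sum]
      simp only [← hgb]
      rfl
    rw [h1, h2, hρ ρ, hρρ] at hcs
    rw [sq]
    exact hcs

end Hessian
-- Continuation of lifts in a complete space
section PathLifting
open scoped Topology
open Filter

/-- A closed set of pairs `(p, t)` in which every pair with `t < 1` can be continued at bounded speed
contains a pair with `t = 1`. -/
theorem exists_mem_of_local_continuation {S : Type*} [EMetricSpace S] [CompleteSpace S]
    {A : Set (S × ℝ)} (hA : IsClosed A) (hne : A.Nonempty) (hA1 : ∀ a ∈ A, a.2 ≤ 1) (K : ℝ)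
    (hK : 0 ≤ K)
    (hstep : ∀ a ∈ A, a.2 < 1 → ∃ b ∈ A, a.2 < b.2 ∧
      edist a.1 b.1 ≤ ENNReal.ofReal (K * (b.2 - a.2))) :
    ∃ p, (p, (1 : ℝ)) ∈ A := by
  -- Zorn's lemma for this transitive relation: `hstep` forces a maximal element to have t = 1, and
  -- completeness bounds chains.
  let r : A → A → Prop := fun a b =>
    a.1.2 ≤ b.1.2 ∧ edist a.1.1 b.1.1 ≤ ENNReal.ofReal (K * (b.1.2 - a.1.2))
  have htrans : ∀ {a b c : A}, r a b → r b c → r a c := by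
    intro a b c hab hbc
    refine ⟨hab.1.trans hbc.1, (edist_triangle _ b.1.1 _).trans ((add_le_add hab.2 hbc.2).trans ?_)⟩
    rw [← ENNReal.ofReal_add (mul_nonneg hK (by linarith [hab.1])) (mul_nonneg hK (by linarith [hbc.1]))]
    exact le_of_eq (by ring_nf)
  have hub : ∀ c : Set A, IsChain r c → ∃ ub, ∀ a ∈ c, r a ub := by
    intro c hc
    rcases c.eq_empty_or_nonempty with rfl | hcne
    · exact ⟨⟨_, hne.some_mem⟩, by simp⟩
    have hcmp : ∀ a ∈ c, ∀ b ∈ c, a.1.2 ≤ b.1.2 →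
        edist a.1.1 b.1.1 ≤ ENNReal.ofReal (K * (b.1.2 - a.1.2)) := by
      intro a ha b hb hab
      rcases eq_or_ne a b with rfl | hne
      · simp
      rcases hc ha hb hne with h | h
      · exact h.2
      · have : a.1.2 = b.1.2 := le_antisymm hab h.1
        rw [edist_comm]
        simpa [this] using h.2
    let Ts : Set ℝ := (fun a : A => a.1.2) '' c
    have hTb : BddAbove Ts := ⟨1, by rintro _ ⟨a, -, rfl⟩; exact hA1 _ a.2⟩
    -- A sequence in the chain with parameters increasing to the supremum `T` has Cauchy points,
    -- since distances are at most `K` times parameter gaps. Its limit, in `A` by closedness, bounds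
    -- the chain.
    obtain ⟨u, humono, hulim, humem⟩ := exists_seq_tendsto_sSup (hcne.image _) hTb
    choose a hac hau using humem
    set T := sSup Ts with hT
    have hle : ∀ b ∈ c, b.1.2 ≤ T := fun b hb => le_csSup hTb ⟨b, hb, rfl⟩
    have hb0 : Tendsto (fun n => ENNReal.ofReal (K * (T - u n))) atTop (𝓝 0) := by
      have : Tendsto (fun n => K * (T - u n)) atTop (𝓝 (K * (T - T))) :=
        (hulim.const_sub T).const_mul K
      simpa using ENNReal.tendsto_ofReal this
    have hclose : ∀ b ∈ c, ∀ n, edist b.1.1 (a n).1.1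
        ≤ ENNReal.ofReal (K * (T - b.1.2)) + ENNReal.ofReal (K * (T - u n)) := by
      intro b hb n
      have h1 := hle b hb
      have h2 := hle (a n) (hac n)
      have h3 : (a n).1.2 = u n := hau n
      rcases le_total b.1.2 (a n).1.2 with h | h
      · refine (hcmp b hb _ (hac n) h).trans (le_trans ?_ le_self_add)
        exact ENNReal.ofReal_le_ofReal (mul_le_mul_of_nonneg_left (by linarith) hK)
      · rw [edist_comm]
        refine (hcmp _ (hac n) b hb h).trans (le_trans ?_ le_add_self)
        exact ENNReal.ofReal_le_ofReal (mul_le_mul_of_nonneg_left (by linarith) hK)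
    have hcauchy : CauchySeq fun n => (a n).1.1 := by
      refine EMetric.cauchySeq_iff_le_tendsto_0.2
        ⟨fun n => ENNReal.ofReal (K * (T - u n)) + ENNReal.ofReal (K * (T - u n)), ?_,
          by simpa using hb0.add hb0⟩
      intro n k M hn hk
      refine (hclose (a n) (hac n) k).trans ?_
      have h3 : (a n).1.2 = u n := hau n
      rw [h3]
      exact add_le_add
        (ENNReal.ofReal_le_ofReal (mul_le_mul_of_nonneg_left (by linarith [humono hn]) hK))
        (ENNReal.ofReal_le_ofReal (mul_le_mul_of_nonneg_left (by linarith [humono hk]) hK))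
    obtain ⟨p, hp⟩ := cauchySeq_tendsto_of_complete hcauchy
    have hmem : (p, T) ∈ A := by
      refine hA.mem_of_tendsto (hp.prodMk_nhds hulim) (Eventually.of_forall fun n => ?_)
      have h3 : (a n).1.2 = u n := hau n
      rw [← h3]
      exact (a n).2
    refine ⟨⟨_, hmem⟩, fun b hb => ⟨hle b hb, ?_⟩⟩
    have := le_of_tendsto_of_tendsto' (tendsto_const_nhds.edist hp) (tendsto_const_nhds.add hb0)
      (hclose b hb)
    simpa using this
  obtain ⟨⟨⟨p, t⟩, hpA⟩, hmax⟩ := exists_maximal_of_chains_bounded hub htrans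
  rcases (hA1 _ hpA).lt_or_eq with h | h
  · obtain ⟨b, hb, hlt, hd⟩ := hstep _ hpA h
    exact absurd (hmax ⟨b, hb⟩ ⟨hlt.le, hd⟩).1 (not_le.2 hlt)
  · exact ⟨p, by simpa only [← h] using hpA⟩

end PathLifting

/-! ### Local sections from the inverse function theorem -/

section LocalInverse
open scoped Topology
open Filter
variable {m : ℕ} {N : Type*} [TopologicalSpace N] [ChartedSpace (EuclideanSpace ℝ (Fin m)) N]
  {S : Type*} [TopologicalSpace S] [ChartedSpace (EuclideanSpace ℝ (Fin m)) S]
  [IsManifold (𝓡 m) ∞ S]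

theorem exists_local_section {P : S → N} (hP : ContMDiff (𝓡 m) (𝓡 m) ∞ P) (p : S)
    (hinj : Function.Injective (mfderiv (𝓡 m) (𝓡 m) P p)) :
    ∃ σ : N → S, σ (P p) = p ∧ ContMDiffAt (𝓡 m) (𝓡 m) ∞ σ (P p) ∧
      ∀ᶠ y in 𝓝 (P p), P (σ y) = y := by
  set x := extChartAt (𝓡 m) p p with hx
  let F := extChartAt (𝓡 m) (P p) ∘ P ∘ (extChartAt (𝓡 m) p).symm
  have hFx : F x = extChartAt (𝓡 m) (P p) (P p) := by
    simp only [F, Function.comp_apply, hx, extChartAt_to_inv]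
  have hF : ContDiffAt ℝ ∞ F x := by
    have := (contMDiffAt_iff.1 (hP p)).2
    rwa [(𝓡 m).range_eq_univ, contDiffWithinAt_univ] at this
  have hD : ∀ v, fderiv ℝ F x v = mfderiv (𝓡 m) (𝓡 m) P p v := by
    intro v
    rw [((hP p).mdifferentiableAt (by simp)).mfderiv, (𝓡 m).range_eq_univ, fderivWithin_univ]
    rfl
  have hker : (fderiv ℝ F x).toLinearMap.ker = ⊥ := by
    rw [LinearMap.ker_eq_bot]
    intro v w hvw
    exact hinj (((hD v).symm.trans hvw).trans (hD w))
  let e : EuclideanSpace ℝ (Fin m) ≃L[ℝ] EuclideanSpace ℝ (Fin m) :=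
    (LinearEquiv.ofInjectiveEndo (fderiv ℝ F x).toLinearMap
      (LinearMap.ker_eq_bot.1 hker)).toContinuousLinearEquiv
  have he : HasFDerivAt F (e : EuclideanSpace ℝ (Fin m) →L[ℝ] EuclideanSpace ℝ (Fin m)) x := by
    have h1 : (e : EuclideanSpace ℝ (Fin m) →L[ℝ] EuclideanSpace ℝ (Fin m)) = fderiv ℝ F x := by
      ext v
      rfl
    rw [h1]
    exact (hF.differentiableAt (by simp)).hasFDerivAt
  let g := hF.localInverse he (by simp)
  have hg : ContDiffAt ℝ ∞ g (F x) := hF.to_localInverse he (by simp)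
  have hgx : g (F x) = x := hF.localInverse_apply_image he (by simp)
  have hright : ∀ᶠ y in 𝓝 (F x), F (g y) = y :=
    (hF.hasStrictFDerivAt' he (by simp)).eventually_right_inverse
  refine ⟨(extChartAt (𝓡 m) p).symm ∘ g ∘ extChartAt (𝓡 m) (P p), ?_, ?_, ?_⟩
  · rw [Function.comp_apply, Function.comp_apply, ← hFx, hgx, hx, extChartAt_to_inv]
  · have h1 : ContMDiffAt (𝓡 m) 𝓘(ℝ, EuclideanSpace ℝ (Fin m)) ∞ (extChartAt (𝓡 m) (P p)) (P p) :=
      contMDiffAt_extChartAt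
    have h2 : ContMDiffAt 𝓘(ℝ, EuclideanSpace ℝ (Fin m)) 𝓘(ℝ, EuclideanSpace ℝ (Fin m)) ∞ g
        (extChartAt (𝓡 m) (P p) (P p)) := by
      rw [← hFx]
      exact hg.contMDiffAt
    have h3 : ContMDiffAt 𝓘(ℝ, EuclideanSpace ℝ (Fin m)) (𝓡 m) ∞ (extChartAt (𝓡 m) p).symm
        (g (extChartAt (𝓡 m) (P p) (P p))) := by
      rw [← hFx, hgx]
      exact (contMDiffOn_extChartAt_symm p).contMDiffAt (extChartAt_target_mem_nhds p)
    exact h3.comp (P p) (h2.comp (P p) h1)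
  · have hcχ : ContinuousAt (extChartAt (𝓡 m) (P p)) (P p) := continuousAt_extChartAt _
    have hcg : ContinuousAt g (extChartAt (𝓡 m) (P p) (P p)) := hFx ▸ hg.continuousAt
    have h1 : ∀ᶠ y in 𝓝 (P p), F (g (extChartAt (𝓡 m) (P p) y)) = extChartAt (𝓡 m) (P p) y :=
      hcχ.eventually (hFx ▸ hright)
    have hc : ContinuousAt (fun y => P ((extChartAt (𝓡 m) p).symm (g (extChartAt (𝓡 m) (P p) y))))
        (P p) := by
      have h2 : ContinuousAt (fun y => g (extChartAt (𝓡 m) (P p) y)) (P p) :=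
        ContinuousAt.comp hcg hcχ
      have h3 : ContinuousAt (fun z => P ((extChartAt (𝓡 m) p).symm z))
          (g (extChartAt (𝓡 m) (P p) (P p))) := by
        rw [← hFx, hgx]
        exact hP.continuous.continuousAt.comp (continuousAt_extChartAt_symm p)
      exact ContinuousAt.comp (g := fun z => P ((extChartAt (𝓡 m) p).symm z)) h3 h2
    have h2 : ∀ᶠ y in 𝓝 (P p), P ((extChartAt (𝓡 m) p).symm (g (extChartAt (𝓡 m) (P p) y)))
        ∈ (extChartAt (𝓡 m) (P p)).source := by
      refine hc.preimage_mem_nhds ?_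
      rw [← hFx, hgx, hx, extChartAt_to_inv]
      exact extChartAt_source_mem_nhds _
    filter_upwards [h1, h2, extChartAt_source_mem_nhds (I := 𝓡 m) (P p)] with y h1 h2 h3
    exact (extChartAt (𝓡 m) (P p)).injOn h2 h3 h1

end LocalInverse
-- Surjectivity of homothetic maps from complete manifolds
section Surjectivity
open scoped Topology
open Filter MeasureTheory
variable {m : ℕ} {N : Type*} [TopologicalSpace N] [ChartedSpace (EuclideanSpace ℝ (Fin m)) N]
  {S : Type*} [EMetricSpace S] [ChartedSpace (EuclideanSpace ℝ (Fin m)) S]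

theorem isOpen_range_of_injective_mfderiv [IsManifold (𝓡 m) ∞ S] {P : S → N}
    (hP : ContMDiff (𝓡 m) (𝓡 m) ∞ P)
    (hinj : ∀ p, Function.Injective (mfderiv (𝓡 m) (𝓡 m) P p)) : IsOpen (range P) := by
  rw [isOpen_iff_mem_nhds]
  rintro _ ⟨p, rfl⟩
  obtain ⟨σ, -, -, h⟩ := exists_local_section hP p (hinj p)
  filter_upwards [h] with y hy
  exact ⟨σ y, hy⟩

variable [RiemannianBundle (fun x : N => TangentSpace (𝓡 m) x)]

set_option synthInstance.maxHeartbeats 400000 in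
theorem exists_ball_chartMetric_le [IsManifold (𝓡 m) ∞ N] [IsContMDiffRiemannianBundle (𝓡 m) ∞ (EuclideanSpace ℝ (Fin m))
      (fun x : N => TangentSpace (𝓡 m) x)] (q : N) :
    ∃ r > 0, ∃ C : ℝ, 0 ≤ C ∧ ∀ z ∈ Metric.ball (extChartAt (𝓡 m) q q) r,
      z ∈ (extChartAt (𝓡 m) q).target ∧ ∀ v, chartMetric q z v v ≤ C * ‖v‖ ^ 2 := by
  obtain ⟨b, hb, hdiff, -, -⟩ := exists_chartMetric_eq (m := m) q
  set y := extChartAt (𝓡 m) q q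
  have hc : ContinuousAt (fun z => ‖b z‖) y :=
    ContinuousAt.norm (E := EuclideanSpace ℝ (Fin m) →L[ℝ] EuclideanSpace ℝ (Fin m) →L[ℝ] ℝ)
      (f := b) (hdiff y (mem_extChartAt_target q)).continuousAt
  have h1 : ∀ᶠ z in 𝓝 y, ‖b z‖ < ‖b y‖ + 1 := hc.eventually_lt_const (lt_add_one _)
  obtain ⟨r, hr, hball⟩ := Metric.eventually_nhds_iff_ball.1
    (h1.and (extChartAt_target_mem_nhds (I := 𝓡 m) q))
  refine ⟨r, hr, ‖b y‖ + 1, by positivity, fun z hz => ⟨(hball z hz).2, fun v => ?_⟩⟩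
  rw [hb]
  calc b z v v ≤ ‖b z v v‖ := le_abs_self _
    _ ≤ ‖b z‖ * ‖v‖ * ‖v‖ := (b z).le_opNorm₂ v v
    _ ≤ (‖b y‖ + 1) * ‖v‖ * ‖v‖ := by
        gcongr
        exact (hball z hz).1.le
    _ = _ := by ring

variable [RiemannianBundle (fun x : S => TangentSpace (𝓡 m) x)]

theorem edist_le_of_inner_mfderiv_le [IsRiemannianManifold (𝓡 m) S] {η : ℝ → S} {a b K : ℝ}
    (hab : a ≤ b)
    (hη : ∀ s ∈ Icc a b, ContMDiffAt 𝓘(ℝ, ℝ) (𝓡 m) 1 η s)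
    (hK : ∀ s ∈ Icc a b, inner ℝ (mfderiv 𝓘(ℝ, ℝ) (𝓡 m) η s 1) (mfderiv 𝓘(ℝ, ℝ) (𝓡 m) η s 1)
      ≤ K ^ 2) (hK0 : 0 ≤ K) :
    edist (η a) (η b) ≤ ENNReal.ofReal (K * (b - a)) := by
  rw [IsRiemannianManifold.out (I := 𝓡 m) (η a) (η b)]
  refine (riemannianEDist_le_pathELength (fun s hs => (hη s hs).contMDiffWithinAt) rfl rfl hab).trans ?_
  rw [pathELength_eq_lintegral_mfderiv_Icc]
  have h : ∀ s ∈ Icc a b, ‖mfderiv 𝓘(ℝ, ℝ) (𝓡 m) η s 1‖ₑ ≤ ENNReal.ofReal K := by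
    intro s hs
    rw [← ofReal_norm]
    refine ENNReal.ofReal_le_ofReal (abs_le_of_sq_le_sq' ?_ hK0).2
    rw [← real_inner_self_eq_norm_sq]
    exact hK s hs
  refine (setLIntegral_mono' measurableSet_Icc h).trans (le_of_eq ?_)
  rw [setLIntegral_const, Real.volume_Icc, ENNReal.ofReal_mul hK0]

/-- A smooth map from a complete manifold to a connected manifold of the same dimension that is
isometric up to a constant factor is surjective. -/
theorem surjective_of_inner_mfderiv_eq [IsManifold (𝓡 m) ∞ N] [IsManifold (𝓡 m) ∞ S]
    [CompleteSpace S] [Nonempty S] [IsRiemannianManifold (𝓡 m) S]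
    [T2Space N] [ConnectedSpace N]
    [IsContMDiffRiemannianBundle (𝓡 m) ∞ (EuclideanSpace ℝ (Fin m))
      (fun x : N => TangentSpace (𝓡 m) x)]
    {P : S → N} (hP : ContMDiff (𝓡 m) (𝓡 m) ∞ P) (c : ℝ)
    (hiso : ∀ p (v : TangentSpace (𝓡 m) p), c ^ 2 *
      inner ℝ (mfderiv (𝓡 m) (𝓡 m) P p v) (mfderiv (𝓡 m) (𝓡 m) P p v) = inner ℝ v v) :
    Function.Surjective P := by
  have iN : IsManifold (𝓡 m) 1 N := IsManifold.of_le (n := ∞) (by simp)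
  have iS : IsManifold (𝓡 m) 1 S := IsManifold.of_le (n := ∞) (by simp)
  have hinj : ∀ p, Function.Injective (mfderiv (𝓡 m) (𝓡 m) P p) := by
    intro p
    rw [injective_iff_map_eq_zero]
    intro v hv
    have h := hiso p v
    rw [hv, inner_zero_left, mul_zero] at h
    exact inner_self_eq_zero.1 h.symm
  have hopen := isOpen_range_of_injective_mfderiv hP hinj
  have hclosed : IsClosed (range P) := by
    rw [← closure_subset_iff_isClosed]
    intro q hq
    obtain ⟨r, hr, C, hC, hball⟩ := exists_ball_chartMetric_le (m := m) q
    set χ := extChartAt (𝓡 m) q with hχ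
    have hnhds : χ ⁻¹' Metric.ball (χ q) r ∩ χ.source ∈ 𝓝 q :=
      inter_mem ((continuousAt_extChartAt q).preimage_mem_nhds (Metric.ball_mem_nhds _ hr))
        (extChartAt_source_mem_nhds q)
    obtain ⟨_, ⟨hqb, hqs⟩, ⟨p₀, rfl⟩⟩ := mem_closure_iff_nhds.1 hq _ hnhds
    let e : ℝ → EuclideanSpace ℝ (Fin m) := AffineMap.lineMap (χ (P p₀)) (χ q)
    have he : ∀ t, HasDerivAt e (χ q - χ (P p₀)) t := fun t => AffineMap.hasDerivAt_lineMap
    have heC : ContDiff ℝ ∞ e := (ContinuousAffineMap.lineMap (R := ℝ) (χ (P p₀)) (χ q)).contDiff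
    have heb : ∀ t ∈ Icc (0 : ℝ) 1, e t ∈ Metric.ball (χ q) r := fun t ht =>
      (convex_ball _ _).lineMap_mem hqb (Metric.mem_ball_self hr) ht
    let γ : ℝ → N := χ.symm ∘ e
    have hγ : ∀ t ∈ Icc (0 : ℝ) 1, ContMDiffAt 𝓘(ℝ, ℝ) (𝓡 m) ∞ γ t := by
      intro t ht
      have h1 : ContMDiffAt 𝓘(ℝ, EuclideanSpace ℝ (Fin m)) (𝓡 m) ∞ χ.symm (e t) :=
        (contMDiffOn_extChartAt_symm q).contMDiffAt
          ((isOpen_extChartAt_target q).mem_nhds (hball _ (heb t ht)).1)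
      exact h1.comp t heC.contDiffAt.contMDiffAt
    -- The chart segment has speed at most √C · ‖χ q - χ (P p₀)‖ in N, and lifting multiplies speeds
    -- by |c|.
    set K : ℝ := |c| * Real.sqrt C * ‖χ q - χ (P p₀)‖ with hKdef
    have hK0 : 0 ≤ K := by positivity
    have hγ' : ∀ t ∈ Icc (0 : ℝ) 1, c ^ 2 * inner ℝ (mfderiv 𝓘(ℝ, ℝ) (𝓡 m) γ t 1)
        (mfderiv 𝓘(ℝ, ℝ) (𝓡 m) γ t 1) ≤ K ^ 2 := by
      intro t ht
      have h1 : (mfderiv 𝓘(ℝ, ℝ) (𝓡 m) γ t 1 : EuclideanSpace ℝ (Fin m))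
          = mfderiv 𝓘(ℝ, EuclideanSpace ℝ (Fin m)) (𝓡 m) χ.symm (e t) (χ q - χ (P p₀)) := by
        have := mfderiv_comp_apply (I := 𝓘(ℝ, ℝ)) (I' := 𝓘(ℝ, EuclideanSpace ℝ (Fin m)))
          (I'' := 𝓡 m) t (g := χ.symm) (f := e)
          (mdifferentiableAt_extChartAt_symm_of_mem (hball _ (heb t ht)).1)
          (he t).differentiableAt.mdifferentiableAt (1 : ℝ)
        refine this.trans ?_
        rw [mfderiv_eq_fderiv, (he t).hasFDerivAt.fderiv]
        congr 1
        exact (one_smul ℝ _)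
      have h2 : inner ℝ (mfderiv 𝓘(ℝ, ℝ) (𝓡 m) γ t 1) (mfderiv 𝓘(ℝ, ℝ) (𝓡 m) γ t 1)
          = chartMetric q (e t) (χ q - χ (P p₀)) (χ q - χ (P p₀)) := by
        rw [chartMetric, chartForm]
        congr 1
      rw [h2, hKdef, mul_pow, mul_pow, sq_abs, Real.sq_sqrt hC, mul_assoc]
      exact mul_le_mul_of_nonneg_left ((hball _ (heb t ht)).2 _) (sq_nonneg c)
    have hγ0 : γ 0 = P p₀ := by
      simp only [γ, e, Function.comp_apply, AffineMap.lineMap_apply_zero]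
      exact χ.left_inv hqs
    have hγ1 : γ 1 = q := by
      simp only [γ, e, Function.comp_apply, AffineMap.lineMap_apply_one]
      exact extChartAt_to_inv q
    -- Pairs (p, t) with `p` over γ(t). A point over γ(1) = q suffices, so no continuous lift of the
    -- whole segment is built.
    let A : Set (S × ℝ) := {a | a.2 ∈ Icc (0 : ℝ) 1 ∧ P a.1 = γ a.2}
    have hA : IsClosed A := by
      have h1 : IsClosed {a : S × ℝ | a.2 ∈ Icc (0 : ℝ) 1} := isClosed_Icc.preimage continuous_snd
      have h2 : ContinuousOn (fun a : S × ℝ => γ a.2) {a : S × ℝ | a.2 ∈ Icc (0 : ℝ) 1} :=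
        fun a ha => ((hγ a.2 ha).continuousAt.comp continuous_snd.continuousAt).continuousWithinAt
      have h3 : ContinuousOn (fun a : S × ℝ => P a.1) {a : S × ℝ | a.2 ∈ Icc (0 : ℝ) 1} :=
        (hP.continuous.comp continuous_fst).continuousOn
      have h4 := (h3.prodMk h2).preimage_isClosed_of_isClosed h1 isClosed_diagonal
      exact h4
    suffices hstep : ∀ a ∈ A, a.2 < 1 → ∃ b ∈ A, a.2 < b.2 ∧
        edist a.1 b.1 ≤ ENNReal.ofReal (K * (b.2 - a.2)) by
      obtain ⟨p, hp⟩ := exists_mem_of_local_continuation hA ⟨(p₀, 0), by simp, hγ0.symm⟩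
        (fun a ha => ha.1.2) K hK0 hstep
      exact ⟨p, hp.2.trans hγ1⟩
    rintro ⟨p, t⟩ ⟨ht, hpt⟩ ht1
    simp only at ht hpt ht1
    obtain ⟨σ, hσp, hσ, hσr⟩ := exists_local_section hP p (hinj p)
    rw [hpt] at hσp hσ hσr
    have hσ1 := (contMDiffAt_iff_contMDiffAt_nhds (n := 1) (by simp)).1 (hσ.of_le (by simp))
    have hev := (hγ t ht).continuousAt.eventually (hσ1.and hσr.eventually_nhds)
    obtain ⟨δ, hδ, hδt⟩ := Metric.eventually_nhds_iff_ball.1 hev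
    -- The half δ keeps [t, t'] inside the open ball on which σ is a C¹ section along γ; the path σ
    -- ∘ γ continues the lift from `p`.
    set t' := min 1 (t + δ / 2) with ht'
    have htt' : t < t' := lt_min ht1 (by linarith)
    have hgood : ∀ s ∈ Icc t t', s ∈ Icc (0 : ℝ) 1 ∧ ContMDiffAt (𝓡 m) (𝓡 m) 1 σ (γ s) ∧
        ∀ᶠ y in 𝓝 (γ s), P (σ y) = y := by
      intro s hs
      have h1 : s ≤ 1 := hs.2.trans (min_le_left _ _)
      have h2 : s ≤ t + δ / 2 := hs.2.trans (min_le_right _ _)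
      refine ⟨⟨ht.1.trans hs.1, h1⟩, hδt s ?_⟩
      rw [Metric.mem_ball, Real.dist_eq, abs_lt]
      constructor <;> linarith [hs.1]
    have hη : ∀ s ∈ Icc t t', ContMDiffAt 𝓘(ℝ, ℝ) (𝓡 m) 1 (σ ∘ γ) s := by
      intro s hs
      obtain ⟨h1, h2, -⟩ := hgood s hs
      exact h2.comp s ((hγ s h1).of_le (by simp))
    have hd : edist ((σ ∘ γ) t) ((σ ∘ γ) t') ≤ ENNReal.ofReal (K * (t' - t)) := by
      refine edist_le_of_inner_mfderiv_le htt'.le hη (fun s hs => ?_) hK0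
      obtain ⟨h1, h2, h3⟩ := hgood s hs
      have h4 : P ∘ (σ ∘ γ) =ᶠ[𝓝 s] γ := (hγ s h1).continuousAt.eventually h3
      have h5 := mfderiv_comp_apply s (hP ((σ ∘ γ) s) |>.mdifferentiableAt (by simp))
        ((hη s hs).mdifferentiableAt (by simp)) (1 : ℝ)
      have h6 := h4.mfderiv_eq (I := 𝓘(ℝ, ℝ)) (I' := 𝓡 m)
      have h7 : (mfderiv (𝓡 m) (𝓡 m) P ((σ ∘ γ) s) (mfderiv 𝓘(ℝ, ℝ) (𝓡 m) (σ ∘ γ) s 1) :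
          EuclideanSpace ℝ (Fin m)) = mfderiv 𝓘(ℝ, ℝ) (𝓡 m) γ s 1 :=
        h5.symm.trans (congrArg (fun L : ℝ →L[ℝ] EuclideanSpace ℝ (Fin m) => L 1) h6)
      rw [← hiso]
      refine le_trans (le_of_eq ?_) (hγ' s h1)
      congr 1
      refine Eq.trans ?_ (inner_tangentSpace_congr (m := m) h4.self_of_nhds _ _)
      congr 1
    refine ⟨(σ (γ t'), t'), ⟨(hgood t' (right_mem_Icc.2 htt'.le)).1,
      (hgood t' (right_mem_Icc.2 htt'.le)).2.2.self_of_nhds⟩, htt', ?_⟩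
    have : (σ ∘ γ) t = p := hσp
    rw [this] at hd
    exact hd
  have huniv := IsClopen.eq_univ ⟨hclosed, hopen⟩ (range_nonempty P)
  exact range_eq_univ.1 huniv

end Surjectivity
-- Functions with vanishing differential
section Constancy
open scoped Topology
open Filter
variable {m : ℕ} {S : Type*} [TopologicalSpace S] [ChartedSpace (EuclideanSpace ℝ (Fin m)) S]

theorem mfderiv_eq_zero_of_coordDeriv_eq_zero {u : S → ℝ}
    (hu : ContMDiff (𝓡 m) 𝓘(ℝ, ℝ) ∞ u) (p : S) (h : ∀ i : Fin m, coordDeriv u p i = 0) :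
    mfderiv (𝓡 m) 𝓘(ℝ, ℝ) u p = 0 := by
  rw [((hu p).mdifferentiableAt (by simp)).mfderiv, (𝓡 m).range_eq_univ, fderivWithin_univ]
  have h' : ∀ v, fderiv ℝ (u ∘ (extChartAt (𝓡 m) p).symm) (extChartAt (𝓡 m) p p) v = 0 := by
    intro v
    rw [← sum_smul_stdVec v]
    simp only [map_sum, map_smul]
    exact Finset.sum_eq_zero fun i _ => by
      have := h i
      rw [coordDeriv] at this
      rw [this, smul_zero]
  exact ContinuousLinearMap.ext h'

theorem isLocallyConstant_of_mfderiv_eq_zero [IsManifold (𝓡 m) ∞ S] {u : S → ℝ}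
    (hu : ContMDiff (𝓡 m) 𝓘(ℝ, ℝ) ∞ u) (h : ∀ p, mfderiv (𝓡 m) 𝓘(ℝ, ℝ) u p = 0) :
    IsLocallyConstant u := by
  have iS : IsManifold (𝓡 m) 1 S := IsManifold.of_le (n := ∞) (by simp)
  rw [IsLocallyConstant.iff_eventually_eq]
  intro p
  obtain ⟨r, hr, hball⟩ := Metric.mem_nhds_iff.1 (extChartAt_target_mem_nhds (I := 𝓡 m) p)
  have hd : ∀ z ∈ Metric.ball (extChartAt (𝓡 m) p p) r,
      HasFDerivAt (u ∘ (extChartAt (𝓡 m) p).symm)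
        (0 : EuclideanSpace ℝ (Fin m) →L[ℝ] ℝ) z := by
    intro z hz
    have h1 := mdifferentiableAt_extChartAt_symm_of_mem (I := 𝓡 m) (hball hz)
    have h2 := (hu ((extChartAt (𝓡 m) p).symm z)).mdifferentiableAt (by simp)
    have h3 := h2.hasMFDerivAt.comp z h1.hasMFDerivAt
    rw [h] at h3
    have h4 := h3.hasFDerivAt
    convert! h4 using 1
  have hsrc : extChartAt (𝓡 m) p ⁻¹' Metric.ball (extChartAt (𝓡 m) p p) r ∈ 𝓝 p :=
    (continuousAt_extChartAt p).preimage_mem_nhds (Metric.ball_mem_nhds _ hr)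
  filter_upwards [hsrc, extChartAt_source_mem_nhds (I := 𝓡 m) p] with q hq hqs
  have := (convex_ball (extChartAt (𝓡 m) p p) r).is_const_of_fderivWithin_eq_zero (𝕜 := ℝ)
    (f := u ∘ (extChartAt (𝓡 m) p).symm)
    (fun z hz => (hd z hz).differentiableAt.differentiableWithinAt)
    (fun z hz => by
      rw [fderivWithin_of_isOpen Metric.isOpen_ball hz]
      exact (hd z hz).fderiv)
    hq (Metric.mem_ball_self hr)
  simpa only [Function.comp_apply, (extChartAt (𝓡 m) p).left_inv hqs, extChartAt_to_inv] using this

end Constancy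

/-! ### The estimate along an Omori–Yau sequence -/

section Estimates

/-- Rearranged, `hL` says H(θA + Mμ(1 - θ)) + 2μQ < ε. Both μ-terms are at most C·M·H(1 - θ²) in
size. Dividing by H ≥ C₁ and using θ ≥ 1/2 (from ε ≤ 1/2 and θ ≥ 0) and 1 - θ² ≤ ε² ≤ ε gives A/2 ≤
2MCε + ε/C₁. -/
theorem le_of_trace_lt {H θ A μ Q M C C₁ ε : ℝ} (hC₁ : 0 < C₁) (hH : C₁ ≤ H) (hM : 0 ≤ M)
    (hθ : 0 ≤ θ) (hδ0 : 0 ≤ 1 - θ ^ 2) (hδ : 1 - θ ^ 2 ≤ ε ^ 2) (hε0 : 0 ≤ ε) (hε : ε ≤ 1 / 2)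
    (hA : 0 ≤ A) (hμ : |μ| ≤ C) (hQ : |2 * Q| ≤ M * H * (1 - θ ^ 2))
    (hL : μ * (M * H + 2 * Q) - θ * (H * (M * μ - A)) < ε) :
    A ≤ ε * (4 * M * C + 2 / C₁) := by
  have hHpos : 0 < H := hC₁.trans_le hH
  have hC : 0 ≤ C := (abs_nonneg μ).trans hμ
  have hθ1 : θ ≤ 1 := by nlinarith
  have hθ2 : 1 / 2 ≤ θ := by nlinarith
  have h1θ : 1 - θ ≤ 1 - θ ^ 2 := by nlinarith
  have e1 : |μ * (2 * Q)| ≤ C * (M * H * (1 - θ ^ 2)) := by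
    rw [abs_mul]
    exact mul_le_mul hμ hQ (abs_nonneg _) hC
  have e2 : |μ * (M * H * (1 - θ))| ≤ C * (M * H * (1 - θ ^ 2)) := by
    rw [abs_mul, abs_of_nonneg (mul_nonneg (mul_nonneg hM hHpos.le) (sub_nonneg.2 hθ1))]
    exact mul_le_mul hμ (mul_le_mul_of_nonneg_left h1θ (mul_nonneg hM hHpos.le))
      (mul_nonneg (mul_nonneg hM hHpos.le) (sub_nonneg.2 hθ1)) hC
  have e3 : H * (θ * A - 2 * (M * C * (1 - θ ^ 2))) < ε := by
    have := (abs_le.1 e1).1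
    have := (abs_le.1 e2).1
    nlinarith
  have e4 : C₁ * (θ * A - 2 * (M * C * (1 - θ ^ 2))) ≤ ε := by
    rcases le_total 0 (θ * A - 2 * (M * C * (1 - θ ^ 2))) with h | h
    · exact (mul_le_mul_of_nonneg_right hH h).trans e3.le
    · exact (mul_nonpos_of_nonneg_of_nonpos hC₁.le h).trans hε0
  have e5 : θ * A - 2 * (M * C * (1 - θ ^ 2)) ≤ ε / C₁ := by
    rw [le_div_iff₀ hC₁]
    linarith
  have e6 : M * C * (1 - θ ^ 2) ≤ M * C * ε :=
    mul_le_mul_of_nonneg_left (by nlinarith) (mul_nonneg hM hC)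
  have e7 : 1 / 2 * A ≤ θ * A := mul_le_mul_of_nonneg_right hθ2 hA
  have e8 : ε * (4 * M * C + 2 / C₁) = 2 * (2 * (M * C * ε) + ε / C₁) := by ring
  rw [e8]
  linarith

/-- The quadratic form of a semidefinite `T` is controlled by its trace against `g`. -/
theorem abs_quadratic_le_trace {m : ℕ} (T g : Matrix (Fin m) (Fin m) ℝ) (ξ : Fin m → ℝ) (c a : ℝ)
    (hc : 0 ≤ c) (ha : 0 ≤ a)
    (hT : (∀ v : Fin m → ℝ, 0 ≤ ∑ i, ∑ j, T i j * v i * v j) ∨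
      (∀ v : Fin m → ℝ, ∑ i, ∑ j, T i j * v i * v j ≤ 0))
    (hg : ∀ i j, g i j = g j i)
    (hξ : ∀ v : Fin m → ℝ, (∑ i, ξ i * v i) ^ 2 ≤ c * ∑ i, ∑ j, g i j * v i * v j)
    (htr : -2 * ∑ i, ∑ j, T i j * g i j = a) :
    |2 * ∑ i, ∑ j, T i j * ξ i * ξ j| ≤ a * c := by
  have hac : 0 ≤ a * c := mul_nonneg ha hc
  rcases hT with h | h
  -- The trace is -a/2 ≤ 0, so in this case the form vanishes at `ξ`.
  · have h1 := quadratic_le_trace T g ξ c h hg hξ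
    have h2 := h ξ
    rw [abs_of_nonneg (by linarith)]
    nlinarith
  · have h1 := quadratic_le_trace (-T) g ξ c (fun v => by simpa using h v) hg hξ
    have h2 := h ξ
    simp only [Matrix.neg_apply, neg_mul, Finset.sum_neg_distrib] at h1
    rw [abs_of_nonpos (by linarith)]
    nlinarith

theorem bounded_logDeriv {R : EReal} (hR : 0 < R) {lam : ℝ → ℝ} (hlam : ContDiffOn ℝ ∞ lam (base R))
    (hlam_pos : ∀ t ∈ base R, 0 < lam t) {r₁ r₂ : ℝ} (hr₁ : r₁ ∈ base R) (hr₂ : r₂ ∈ base R) :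
    ∃ C, ∀ t ∈ Icc r₁ r₂, |warpDeriv R lam t / lam t| ≤ C := by
  have hsub : Icc r₁ r₂ ⊆ base R := fun t ht =>
    ⟨hr₁.1.trans ht.1, lt_of_le_of_lt (by exact_mod_cast ht.2) hr₂.2⟩
  have hc : ContinuousOn (fun t => warpDeriv R lam t / lam t) (base R) :=
    (hlam.continuousOn_derivWithin (uniqueDiffOn_base hR) (by simp)).div hlam.continuousOn
      fun t ht => (hlam_pos t ht).ne'
  obtain ⟨C, hC⟩ := isCompact_Icc.exists_bound_of_continuousOn (hc.mono hsub)
  exact ⟨C, fun t ht => hC t ht⟩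

end Estimates
end WarpedProduct

/-! ### The rigidity theorem -/

theorem theorem1p3
    -- the dimension `m = n - 1` of the hypersurface, and the order `k`
    (m k : ℕ) (hk : 2 * k ≤ m)
    -- the connected Riemannian fiber `N` of dimension `m`
    (N : Type*) [TopologicalSpace N] [T2Space N] [ConnectedSpace N]
    [ChartedSpace (EuclideanSpace ℝ (Fin m)) N] [IsManifold (𝓡 m) ∞ N]
    [RiemannianBundle (fun x : N => TangentSpace (𝓡 m) x)]
    [IsContMDiffRiemannianBundle (𝓡 m) ∞ (EuclideanSpace ℝ (Fin m))
      (fun x : N => TangentSpace (𝓡 m) x)]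
    -- the warping function on `[0, R)`, `0 < R ≤ ∞`
    (R : EReal) (hR : 0 < R) (lam : ℝ → ℝ) (hlam : ContDiffOn ℝ ∞ lam (base R))
    (hlam_pos : ∀ t ∈ base R, 0 < lam t)
    -- the connected complete Riemannian manifold `S` with its Riemannian distance
    (S : Type*) [EMetricSpace S] [CompleteSpace S] [ConnectedSpace S]
    [ChartedSpace (EuclideanSpace ℝ (Fin m)) S] [IsManifold (𝓡 m) ∞ S]
    [RiemannianBundle (fun x : S => TangentSpace (𝓡 m) x)]
    [IsContMDiffRiemannianBundle (𝓡 m) ∞ (EuclideanSpace ℝ (Fin m))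
      (fun x : S => TangentSpace (𝓡 m) x)]
    [IsRiemannianManifold (𝓡 m) S]
    -- the hypersurface, with its outer unit normal; it is star-shaped
    (f : S → ℝ × N) (hf : IsIsometricImmersion m R lam f)
    (ν : ∀ p, TangentSpace (prodModel m) (f p)) (hν : IsUnitNormal lam f ν)
    (hstar : ∀ p, 0 ≤ warpedMetric lam (f p) (radial (f p)) (ν p))
    -- it lies in a slab `[r₁, r₂] × N`
    (r₁ r₂ : ℝ) (hr₁ : r₁ ∈ base R) (hr₂ : r₂ ∈ base R) (hslab : ∀ p, (f p).1 ∈ Set.Icc r₁ r₂)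
    (hE : IsSemidefinite (fun p : S => genEinstein m k p))
    (hOY : OmoriYau (fun p : S => (-2 : ℝ) • genEinstein m k p))
    (C₁ C₂ : ℝ) (hC₁ : 0 < C₁) (hH : ∀ p : S, C₁ ≤ gaussBonnet m k p ∧ gaussBonnet m k p ≤ C₂)
    (hle : ∀ p : S, oddCurvature R lam f ν k p / gaussBonnet m k p
      ≤ ((m : ℝ) - 2 * k) * (warpDeriv R lam (f p).1 / lam (f p).1))
    (hgrad : ∀ p : S, gradNorm m (fun q => (f q).1) p
      ≤ ⨅ q : S, (((m : ℝ) - 2 * k) * (warpDeriv R lam (f q).1 / lam (f q).1)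
          - oddCurvature R lam f ν k q / gaussBonnet m k q)) :
    ∃ r₀ ∈ base R, Set.range f = {r₀} ×ˢ Set.univ := by
  have hu : ContMDiff (𝓡 m) 𝓘(ℝ, ℝ) ∞ (fun q => (f q).1) := contMDiff_fst.comp hf.smooth
  have hM : (0 : ℝ) ≤ (m : ℝ) - 2 * k := by
    have : ((2 * k : ℕ) : ℝ) ≤ m := by exact_mod_cast hk
    push_cast at this
    linarith
  obtain ⟨C, hC⟩ := bounded_logDeriv hR hlam hlam_pos hr₁ hr₂
  set A : S → ℝ := fun q => ((m : ℝ) - 2 * k) * (warpDeriv R lam (f q).1 / lam (f q).1)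
    - oddCurvature R lam f ν k q / gaussBonnet m k q with hA
  have hA0 : ∀ q, 0 ≤ A q := fun q => sub_nonneg.2 (hle q)
  have hAbdd : BddBelow (range A) := ⟨0, by rintro _ ⟨q, rfl⟩; exact hA0 q⟩
  have hgeom := height_function_geometry hR hlam hlam_pos hf ν hν
  have hgradsq : ∀ p, gradNorm m (fun q => (f q).1) p
      = Real.sqrt (1 - warpedMetric lam (f p) (radial (f p)) (ν p) ^ 2) := by
    intro p
    rw [gradNorm, (hgeom p).2.1]
  have hkey : ∀ (p : S) (ε : ℝ), 0 ≤ ε → ε ≤ 1 / 2 → gradNorm m (fun q => (f q).1) p < ε →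
      traceOp (fun p : S => (-2 : ℝ) • genEinstein m k p) (fun q => (f q).1) p < ε →
      A p ≤ ε * (4 * ((m : ℝ) - 2 * k) * C + 2 / C₁) := by
    intro p ε hε0 hε hg hL
    obtain ⟨hhess, -, hδ0, hcs⟩ := hgeom p
    have hHp : 0 < gaussBonnet m k p := hC₁.trans_le (hH p).1
    have htr := sum_genEinstein_mul (m := m) k p _ (sum_gramInv_mul_gram (m := m) p)
    have hQ := abs_quadratic_le_trace (genEinstein m k p) _ _ _ _ hδ0
      (mul_nonneg hM hHp.le) (hE p) (gram_symm (m := m) p _) hcs htr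
    refine le_of_trace_lt hC₁ (hH p).1 hM (hstar p) hδ0 ?_ hε0 hε (hA0 p) (hC _ (hslab p)) hQ ?_
    · rw [hgradsq, Real.sqrt_lt' (hε0.lt_of_ne ?_)] at hg
      · exact hg.le
      · rintro rfl
        exact absurd hg (not_lt.2 (Real.sqrt_nonneg _))
    · refine lt_of_le_of_lt (le_of_eq ?_) hL
      -- Solving the definition of `A` for H_{2k+1} puts the traced Hessian formula into the shape
      -- required by `le_of_trace_lt`.
      have hO : gaussBonnet m k p * (((m : ℝ) - 2 * k) * (warpDeriv R lam (f p).1 / lam (f p).1)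
          - A p) = oddCurvature R lam f ν k p := by
        rw [hA]
        field_simp
        ring
      rw [hO, ← htr, traceOp, oddCurvature]
      simp only [hhess, Matrix.smul_apply, smul_eq_mul, Finset.mul_sum,
        ← Finset.sum_add_distrib, ← Finset.sum_sub_distrib]
      exact Finset.sum_congr rfl fun i _ => Finset.sum_congr rfl fun j _ => by ring
  have hinf : ⨅ q, A q ≤ 0 := by
    obtain ⟨pt, hpt⟩ := hOY (fun q => (f q).1) (hu.of_le (by norm_cast))
      ⟨r₂, by rintro _ ⟨q, rfl⟩; exact (hslab q).2⟩
    have hlim : Filter.Tendsto (fun i : ℕ => 1 / (i : ℝ) * (4 * ((m : ℝ) - 2 * k) * C + 2 / C₁))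
        Filter.atTop (nhds 0) := by
      simpa using tendsto_one_div_atTop_nhds_zero_nat.mul_const (4 * ((m : ℝ) - 2 * k) * C + 2 / C₁)
    refine ge_of_tendsto hlim ?_
    -- i ≥ 2 ensures 1/i ≤ 1/2, as `hkey` requires.
    filter_upwards [Filter.eventually_ge_atTop 2] with i hi
    have hi' : (2 : ℝ) ≤ i := by exact_mod_cast hi
    obtain ⟨-, h1, h2⟩ := hpt i (by omega)
    exact (ciInf_le hAbdd (pt i)).trans
      (hkey (pt i) _ (by positivity) (one_div_le_one_div_of_le (by norm_num) hi') h1 h2)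
  have hcoord : ∀ p (i : Fin m), coordDeriv (fun q => (f q).1) p i = 0 := by
    intro p i
    obtain ⟨-, -, hδ0, hcs⟩ := hgeom p
    have h1 := (hgrad p).trans hinf
    rw [hgradsq] at h1
    have h2 := hδ0.antisymm' (Real.sqrt_eq_zero'.1 (h1.antisymm (Real.sqrt_nonneg _)))
    -- Cauchy–Schwarz tested on the i-th basis vector: r_i² ≤ |∇r|² g_{ii} = 0.
    have h3 := hcs (Pi.single i 1)
    rw [h2, zero_mul] at h3
    simpa [Pi.single_apply] using h3.antisymm (sq_nonneg _)
  have hmf : ∀ p, mfderiv (𝓡 m) 𝓘(ℝ, ℝ) (fun q => (f q).1) p = 0 := fun p =>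
    mfderiv_eq_zero_of_coordDeriv_eq_zero hu p (hcoord p)
  have hconst := isLocallyConstant_of_mfderiv_eq_zero hu hmf
  obtain ⟨p₀⟩ := (inferInstance : Nonempty S)
  have hr : ∀ p, (f p).1 = (f p₀).1 := fun p => hconst.apply_eq_of_isPreconnected
    isPreconnected_univ (mem_univ _) (mem_univ _)
  have hsurj : Function.Surjective (fun p => (f p).2) := by
    -- Since dr = 0, the isometry condition reduces to λ(r₀)²|dP v|² = |v|² for the projection P to
    -- N.
    refine surjective_of_inner_mfderiv_eq (contMDiff_snd.comp hf.smooth) (lam (f p₀).1) fun p v => ?_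
    have hfd : MDifferentiableAt (𝓡 m) (prodModel m) f p :=
      (hf.smooth p).mdifferentiableAt (by simp)
    have h1 := hf.isometric p v v
    rw [warpedMetric, dRadial_mfderiv hfd, dFiber_mfderiv hfd, hmf p, hr p] at h1
    rw [← h1]
    exact ((congrArg (· + _) (zero_mul (0 : ℝ))).trans (zero_add _)).symm
  refine ⟨(f p₀).1, hf.mem_base p₀, Set.ext fun y => ⟨?_, ?_⟩⟩
  · rintro ⟨p, rfl⟩
    exact ⟨hr p, mem_univ _⟩
  · rintro ⟨hy, -⟩
    obtain ⟨p, hp⟩ := hsurj y.2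
    exact ⟨p, Prod.ext ((hr p).trans hy.symm) hp⟩
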